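/- **Proposition.** Let $M$ be a smooth $n$-dimensional manifold with a Finsler structure $F:TM\to\mathbb R$, i.e. $F\ge 0$, with $F(x,y)=0$ iff $y=0$; $F$ is $C^\infty$ on the slit tangent bundle $TM\setminus\{0\}$; $F(x,\lambda y)=\lambda F(x,y)$ for $\lambda>0$; and the matrix $g_{ij}=\tfrac12\dot\partial_i\dot\partial_jF^2$ is positive definite at every $(x,y)$ with $y\ne0$. Let $\sigma:M\to\mathbb R$ be smooth and put $\overline F=e^{\sigma(x)}F$. In any local coordinates $(x^i)$ of $M$, with induced fibre coordinates $(y^i)$, write $\partial_i=\partial/\partial x^i$, $\dot\partial_i=\partial/\partial y^i$, $\sigma_r=\partial_r\sigma$, let $(g^{ij})$ be the inverse matrix of $(g_{ij})$ (used to raise indices; $g_{ij}$ lowers them), sum over repeated indices, and set $$\ell_i=\dot\partial_iF,\quad h_{ij}=g_{ij}-\ell_i\ell_j,\quad C_{ijk}=\tfrac12\dot\partial_kg_{ij},\quad C_{ijkh}=\dot\partial_hC_{ijk},\quad C_{lijkh}=\dot\partial_hC_{lijk},$$ $$C^h_{ij}=C_{ijk}g^{kh},\quad C^{ir}_j=g^{ia}g^{rb}C_{abj},\quad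 C^r_{ijk}=g^{rl}C_{lijk},\quad C^{ir}_{jk}=g^{ia}g^{rb}C_{abjk},\quad C^{ir}_{jkh}=g^{ia}g^{rb}C_{abjkh},$$ $$T_{rijk}=FC_{rijk}-F(C_{sij}C^s_{rk}+C_{sjr}C^s_{ik}+C_{sir}C^s_{jk})+C_{rij}\ell_k+C_{rik}\ell_j+C_{rjk}\ell_i+C_{ijk}\ell_r,$$ $$T^r_{ijk}=g^{ra}T_{aijk},\quad T^{ri}_{jk}=g^{ra}g^{ib}T_{abjk},\quad S_i{}^h{}_{jk}=C^r_{ik}C^h_{rj}-C^r_{ij}C^h_{rk}$$ (the T-tensor and the v-curvature of the Cartan connection), and $$G^i=\tfrac14g^{ih}(y^r\partial_r\dot\partial_hF^2-\partial_hF^2),\quad G^i_j=\dot\partial_jG^i,\quad G^i_{jk}=\dot\partial_kG^i_j,\quad G^i_{jkh}=\dot\partial_hG^i_{jk}$$ (the last is the Berwald tensor). Let $\overline G^i_{jkh}$ be the Berwald tensor of $\overline F$. Then at every $(x,y)$ with $y\neq0$ and for all $i,j,k,h$, $$\overline G^i_{jkh}=G^i_{jkh}+B^i_{jkh},$$ where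 $$\begin{aligned}B^i_{jkh}={}&F^2\sigma_rC^{ir}_{jkh}+2\sigma_r(C^{ir}_jg_{kh}+C^{ir}_hg_{jk}+C^{ir}_kg_{jh})-2\sigma_rg^{ir}C_{jkh}+2F\sigma_r(C^{ir}_{jk}\ell_h+C^{ir}_{hj}\ell_k+C^{ir}_{kh}\ell_j)\\&-4F\sigma_r\big((C^r_{sj}C^{si}_k+C^i_{sj}C^{sr}_k)\ell_h+(C^r_{sj}C^{si}_h+C^i_{sj}C^{sr}_h)\ell_k+(C^r_{sk}C^{si}_h+C^i_{sk}C^{sr}_h)\ell_j\big)\\&-2F^2\sigma_r\big((C^r_{sjk}C^{si}_h+C^i_{sjk}C^{sr}_h)+(C^r_{sjh}C^{si}_k+C^i_{sjh}C^{sr}_k)+(C^r_{skh}C^{si}_j+C^i_{skh}C^{sr}_j)\big)\\&+4F^2\sigma_r\big((C_{stj}C^{ti}_k+C_{stk}C^{ti}_j)C^{sr}_h+(C_{stj}C^{it}_h+C_{sth}C^{it}_j)C^{sr}_k+(C_{stk}C^{it}_h+C_{sth}C^{it}_k)C^{sr}_j\big).\end{aligned}$$ Moreover, in terms of the T-tensor,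 $$\begin{aligned}B^i_{jkh}={}&F\sigma_r\dot\partial_hT^{ri}_{jk}+\sigma_r(T^{ri}_{jh}\ell_k+T^{ri}_{kh}\ell_j+T^{ri}_{jk}\ell_h-T^r_{jkh}\ell^i-T^i_{jkh}\ell^r)\\&-F\sigma_r(T^i_{sjh}C^{sr}_k+T^r_{skh}C^{si}_j+T^r_{sjh}C^{si}_k+T^i_{skh}C^{sr}_j-T^{ri}_{sh}C^s_{jk}-T^s_{jkh}C^{ri}_s)\\&+\sigma_r(C^{ri}_jh_{kh}+C^{ri}_kh_{jh}+2C^{ir}_hh_{jk}-C^r_{jk}h^i_h-C^i_{jk}h^r_h-2C_{jkh}h^{ir})\\&+F^2\sigma_r\big[C^t_{hj}S_t{}^{ir}{}_k+C^t_{hk}S_t{}^{ri}{}_j-C^{ti}_hS_{tjk}{}^r-C^{tr}_hS_{tkj}{}^i-C^{ti}_jS_{thk}{}^r-C^{tr}_kS_{thj}{}^i\big].\end{aligned}$$ -/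

import Mathlib

open scoped Manifold ContDiff

noncomputable section

namespace Finsler

/-- The coordinate space `ℝⁿ`. -/
abbrev Coord (n : ℕ) : Type := EuclideanSpace ℝ (Fin n)

/-- Functions `f(x, y)` of the coordinates `x` of a point and `y` of a tangent vector at it. -/
abbrev LocalFn (n : ℕ) : Type := Coord n → Coord n → ℝ

/-- The partial derivative with respect to `xⁱ` of a function of `x`. -/
def partialD {n : ℕ} (i : Fin n) (s : Coord n → ℝ) (x : Coord n) : ℝ :=
  fderiv ℝ s x (EuclideanSpace.single i 1)

/-- `∂ᵢ f`, the partial derivative of `f(x, y)` with respect to `xⁱ`. -/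
def baseD {n : ℕ} (i : Fin n) (f : LocalFn n) : LocalFn n := fun x y =>
  partialD i (fun x' => f x' y) x

/-- `∂̇ᵢ f`, the partial derivative of `f(x, y)` with respect to `yⁱ`. -/
def dotD {n : ℕ} (i : Fin n) (f : LocalFn n) : LocalFn n := fun x y =>
  partialD i (f x) y

/-! ### Objects attached to the coordinate expression `F(x, y)` -/

/-- `F²`. -/
def sq {n : ℕ} (F : LocalFn n) : LocalFn n := fun x y => F x y ^ 2

/-- The metric tensor `g_{ij} = ½ ∂̇ᵢ ∂̇ⱼ F²`. -/
def g {n : ℕ} (F : LocalFn n) (i j : Fin n) : LocalFn n := fun x y =>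
  (1 / 2) * dotD i (dotD j (sq F)) x y

/-- The matrix `(g_{ij}(x, y))`. -/
def gMatrix {n : ℕ} (F : LocalFn n) (x y : Coord n) : Matrix (Fin n) (Fin n) ℝ :=
  Matrix.of fun i j => g F i j x y

/-- The inverse metric tensor `g^{ij}`. -/
def gInv {n : ℕ} (F : LocalFn n) (i j : Fin n) : LocalFn n := fun x y =>
  (gMatrix F x y)⁻¹ i j

/-- The normalized supporting element `ℓᵢ = ∂̇ᵢ F`. -/
def ell {n : ℕ} (F : LocalFn n) (i : Fin n) : LocalFn n := dotD i F

/-- `ℓⁱ = g^{ia} ℓ_a`. -/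
def ellU {n : ℕ} (F : LocalFn n) (i : Fin n) : LocalFn n := fun x y =>
  ∑ a, gInv F i a x y * ell F a x y

/-- The angular metric tensor `h_{ij} = g_{ij} - ℓᵢ ℓⱼ`. -/
def ang {n : ℕ} (F : LocalFn n) (i j : Fin n) : LocalFn n := fun x y =>
  g F i j x y - ell F i x y * ell F j x y

/-- `hⁱⱼ = g^{ia} h_{aj}`. -/
def angU {n : ℕ} (F : LocalFn n) (i j : Fin n) : LocalFn n := fun x y =>
  ∑ a, gInv F i a x y * ang F a j x y

/-- `h^{ir} = g^{ia} g^{rb} h_{ab}`. -/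
def angUU {n : ℕ} (F : LocalFn n) (i r : Fin n) : LocalFn n := fun x y =>
  ∑ a, ∑ b, gInv F i a x y * gInv F r b x y * ang F a b x y

/-- The Cartan tensor `C_{ijk} = ½ ∂̇ₖ g_{ij}`. -/
def C {n : ℕ} (F : LocalFn n) (i j k : Fin n) : LocalFn n := fun x y =>
  (1 / 2) * dotD k (g F i j) x y

/-- `C_{ijkh} = ∂̇ₕ C_{ijk}`. -/
def C4 {n : ℕ} (F : LocalFn n) (i j k h : Fin n) : LocalFn n := dotD h (C F i j k)

/-- `C_{lijkh} = ∂̇ₕ C_{lijk}`. -/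
def C5 {n : ℕ} (F : LocalFn n) (l i j k h : Fin n) : LocalFn n := dotD h (C4 F l i j k)

/-- `Cʰ_{ij} = C_{ijk} g^{kh}`. -/
def CU {n : ℕ} (F : LocalFn n) (h i j : Fin n) : LocalFn n := fun x y =>
  ∑ k, C F i j k x y * gInv F k h x y

/-- `C^{ir}_j = g^{ia} g^{rb} C_{abj}`. -/
def CUU {n : ℕ} (F : LocalFn n) (i r j : Fin n) : LocalFn n := fun x y =>
  ∑ a, ∑ b, gInv F i a x y * gInv F r b x y * C F a b j x y

/-- `Cʳ_{ijk} = g^{rl} C_{lijk}`. -/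
def C4U {n : ℕ} (F : LocalFn n) (r i j k : Fin n) : LocalFn n := fun x y =>
  ∑ l, gInv F r l x y * C4 F l i j k x y

/-- `C^{ir}_{jk} = g^{ia} g^{rb} C_{abjk}`. -/
def C4UU {n : ℕ} (F : LocalFn n) (i r j k : Fin n) : LocalFn n := fun x y =>
  ∑ a, ∑ b, gInv F i a x y * gInv F r b x y * C4 F a b j k x y

/-- `C^{ir}_{jkh} = g^{ia} g^{rb} C_{abjkh}`. -/
def C5UU {n : ℕ} (F : LocalFn n) (i r j k h : Fin n) : LocalFn n := fun x y =>
  ∑ a, ∑ b, gInv F i a x y * gInv F r b x y * C5 F a b j k h x y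

/-- The T-tensor `T_{rijk}`. -/
def T {n : ℕ} (F : LocalFn n) (r i j k : Fin n) : LocalFn n := fun x y =>
  F x y * C4 F r i j k x y
    - F x y * (∑ s, (C F s i j x y * CU F s r k x y + C F s j r x y * CU F s i k x y
        + C F s i r x y * CU F s j k x y))
    + C F r i j x y * ell F k x y + C F r i k x y * ell F j x y
    + C F r j k x y * ell F i x y + C F i j k x y * ell F r x y

/-- `Tʳ_{ijk} = g^{ra} T_{aijk}`. -/
def TU {n : ℕ} (F : LocalFn n) (r i j k : Fin n) : LocalFn n := fun x y =>
  ∑ a, gInv F r a x y * T F a i j k x y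

/-- `T^{ri}_{jk} = g^{ra} g^{ib} T_{abjk}`. -/
def TUU {n : ℕ} (F : LocalFn n) (r i j k : Fin n) : LocalFn n := fun x y =>
  ∑ a, ∑ b, gInv F r a x y * gInv F i b x y * T F a b j k x y

/-- The v-curvature of the Cartan connection,
`S_i{}^h{}_{jk} = Cʳ_{ik} Cʰ_{rj} - Cʳ_{ij} Cʰ_{rk}`. -/
def S {n : ℕ} (F : LocalFn n) (i h j k : Fin n) : LocalFn n := fun x y =>
  ∑ r, (CU F r i k x y * CU F h r j x y - CU F r i j x y * CU F h r k x y)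

/-- `S_i{}^{hj}{}_k = g^{ja} S_i{}^h{}_{ak}`. -/
def SUU {n : ℕ} (F : LocalFn n) (i h j k : Fin n) : LocalFn n := fun x y =>
  ∑ a, gInv F j a x y * S F i h a k x y

/-- `S_{ihj}{}^k = g_{hb} g^{ka} S_i{}^b{}_{ja}`. -/
def SL {n : ℕ} (F : LocalFn n) (i h j k : Fin n) : LocalFn n := fun x y =>
  ∑ a, ∑ b, g F h b x y * gInv F k a x y * S F i b j a x y

/-- The geodesic coefficients `Gⁱ = ¼ g^{ih} (yʳ ∂ᵣ ∂̇ₕ F² - ∂ₕ F²)`. -/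
def spray {n : ℕ} (F : LocalFn n) (i : Fin n) : LocalFn n := fun x y =>
  (1 / 4) * ∑ h, gInv F i h x y *
    ((∑ r, y r * baseD r (dotD h (sq F)) x y) - baseD h (sq F) x y)

/-- The nonlinear connection `Gⁱ_j = ∂̇ⱼ Gⁱ`. -/
def nonlinearConn {n : ℕ} (F : LocalFn n) (i j : Fin n) : LocalFn n := dotD j (spray F i)

/-- The coefficients `Gⁱ_{jk} = ∂̇ₖ Gⁱ_j` of the Berwald connection. -/
def berwaldConn {n : ℕ} (F : LocalFn n) (i j k : Fin n) : LocalFn n :=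
  dotD k (nonlinearConn F i j)

/-- The Berwald tensor `Gⁱ_{jkh} = ∂̇ₕ Gⁱ_{jk}`. -/
def berwaldTensor {n : ℕ} (F : LocalFn n) (i j k h : Fin n) : LocalFn n :=
  dotD h (berwaldConn F i j k)

/-- The tensor `Bⁱ_{jkh}` in terms of the Cartan tensor and its `y`-derivatives; `s` is the
coordinate expression of the conformal exponent `σ`, and `σ_r = ∂_r σ`. -/
def conformalB {n : ℕ} (F : LocalFn n) (s : Coord n → ℝ) (i j k h : Fin n) : LocalFn n :=
  fun x y => ∑ r, partialD r s x * (
    F x y ^ 2 * C5UU F i r j k h x y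
    + 2 * (CUU F i r j x y * g F k h x y + CUU F i r h x y * g F j k x y
        + CUU F i r k x y * g F j h x y)
    - 2 * gInv F i r x y * C F j k h x y
    + 2 * F x y * (C4UU F i r j k x y * ell F h x y + C4UU F i r h j x y * ell F k x y
        + C4UU F i r k h x y * ell F j x y)
    - 4 * F x y * (∑ q,
        ((CU F r q j x y * CUU F q i k x y + CU F i q j x y * CUU F q r k x y) * ell F h x y
        + (CU F r q j x y * CUU F q i h x y + CU F i q j x y * CUU F q r h x y) * ell F k x y
        + (CU F r q k x y * CUU F q i h x y + CU F i q k x y * CUU F q r h x y) * ell F j x y))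
    - 2 * F x y ^ 2 * (∑ q,
        ((C4U F r q j k x y * CUU F q i h x y + C4U F i q j k x y * CUU F q r h x y)
        + (C4U F r q j h x y * CUU F q i k x y + C4U F i q j h x y * CUU F q r k x y)
        + (C4U F r q k h x y * CUU F q i j x y + C4U F i q k h x y * CUU F q r j x y)))
    + 4 * F x y ^ 2 * (∑ q, ∑ t,
        ((C F q t j x y * CUU F t i k x y + C F q t k x y * CUU F t i j x y) * CUU F q r h x y
        + (C F q t j x y * CUU F i t h x y + C F q t h x y * CUU F i t j x y) * CUU F q r k x y
        + (C F q t k x y * CUU F i t h x y + C F q t h x y * CUU F i t k x y)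
            * CUU F q r j x y)))

/-- The tensor `Bⁱ_{jkh}` in terms of the T-tensor, its `y`-derivative, the angular metric and the
v-curvature of the Cartan connection. -/
def conformalBT {n : ℕ} (F : LocalFn n) (s : Coord n → ℝ) (i j k h : Fin n) : LocalFn n :=
  fun x y => ∑ r, partialD r s x * (
    F x y * dotD h (TUU F r i j k) x y
    + (TUU F r i j h x y * ell F k x y + TUU F r i k h x y * ell F j x y
        + TUU F r i j k x y * ell F h x y - TU F r j k h x y * ellU F i x y
        - TU F i j k h x y * ellU F r x y)
    - F x y * (∑ q,
        (TU F i q j h x y * CUU F q r k x y + TU F r q k h x y * CUU F q i j x y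
        + TU F r q j h x y * CUU F q i k x y + TU F i q k h x y * CUU F q r j x y
        - TUU F r i q h x y * CU F q j k x y - TU F q j k h x y * CUU F r i q x y))
    + (CUU F r i j x y * ang F k h x y + CUU F r i k x y * ang F j h x y
        + 2 * CUU F i r h x y * ang F j k x y - CU F r j k x y * angU F i h x y
        - CU F i j k x y * angU F r h x y - 2 * C F j k h x y * angUU F i r x y)
    + F x y ^ 2 * (∑ t,
        (CU F t h j x y * SUU F t i r k x y + CU F t h k x y * SUU F t r i j x y
        - CUU F t i h x y * SL F t j k r x y - CUU F t r h x y * SL F t k j i x y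
        - CUU F t i j x y * SL F t h k r x y - CUU F t r k x y * SL F t h j i x y)))

/-! ### Finsler structures on a manifold and their coordinate expressions -/

section Manifold

variable {n : ℕ} {M : Type*} [TopologicalSpace M] [ChartedSpace (EuclideanSpace ℝ (Fin n)) M]

/-- The expression `F(x, y)` of a function on `TM` in the coordinates of `TM` induced by a local
coordinate system `φ` of `M`: the point has coordinates `x`, and the vector is `yⁱ ∂/∂xⁱ`. -/
def localExpr (φ : OpenPartialHomeomorph M (Coord n)) (F : TangentBundle (𝓡 n) M → ℝ) :
    LocalFn n := fun x y =>
  F ⟨φ.symm x, mfderiv (𝓡 n) (𝓡 n) φ.symm x y⟩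

/-- A Finsler structure on the smooth `n`-dimensional manifold `M`. -/
structure IsFinslerStructure [IsManifold (𝓡 n) ∞ M] (F : TangentBundle (𝓡 n) M → ℝ) : Prop where
  nonneg : ∀ v, 0 ≤ F v
  eq_zero_iff : ∀ v, F v = 0 ↔ v.2 = 0
  smooth : ContMDiffOn (𝓡 n).tangent 𝓘(ℝ, ℝ) ∞ F {v | v.2 ≠ 0}
  homogeneous : ∀ (p : M) (v : TangentSpace (𝓡 n) p) (c : ℝ), 0 < c →
    F ⟨p, c • v⟩ = c * F ⟨p, v⟩
  posDef : ∀ φ ∈ IsManifold.maximalAtlas (𝓡 n) ∞ M, ∀ x ∈ φ.target, ∀ y : Coord n, y ≠ 0 →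
    (gMatrix (localExpr φ F) x y).PosDef

/-- The conformal transformation `F̄ = e^{σ(x)} F`. -/
def conformal (σ : M → ℝ) (F : TangentBundle (𝓡 n) M → ℝ) : TangentBundle (𝓡 n) M → ℝ :=
  fun v => Real.exp (σ v.1) * F v

end Manifold

end Finsler

end

noncomputable section

namespace Finsler

variable {n : ℕ}

/-! ### Partial derivatives at a point -/

/-! The geodesic coefficients change under F̄ = e^σ F by the simple rule Ḡ^i = G^i + (σ_r y^r) y^i −
½ σ_r F² g^{ir}, proved in `spray_localConformal`. The factor e^{2σ} cancels against its inverse in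
ḡ^{ih}; only the x-derivatives falling on e^{2σ} survive, and g^{ih} F ℓ_h = y^i turns the first of
them into the quadratic term. Three y-derivatives kill that quadratic term, so B is −½ σ_r times the
third y-derivative of F² g^{ir}, computed in `hasPartialD₃_sq_mul_gInv`. This needs only ∂̇_h g^{-1}
= −2 g^{-1} C_h g^{-1}, the product rule and the symmetries of the Cartan tensor and its
derivatives.

The T-tensor form (`conformalB_coeff_eq`) is an algebraic identity, valid for each i and r before
contraction with σ_r. T_{abjk} is split into a matrix in a, b without ℓ_a, ℓ_b and two outer
products (`T_eq`). Every tensor is then written as a matrix with both indices raised (`raise`) or as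
a product of matrices joined by g^{-1} (`contr`). Contractions of C with ℓ vanish by Euler's
theorem, and after transpositions have fixed the index order both sides agree as polynomials.

The statement on the manifold follows because, in any chart, a Finsler structure gives a smooth
family of Minkowski norms (`IsFinslerStructure.isFinslerOn`). -/

/-- `f` is differentiable at `y`, and its partial derivative in the `h`-th coordinate is `d`. -/
def HasPartialD (h : Fin n) (f : Coord n → ℝ) (d : ℝ) (y : Coord n) : Prop :=
  DifferentiableAt ℝ f y ∧ partialD h f y = d

namespace HasPartialD

variable {h : Fin n} {f f₁ f₂ : Coord n → ℝ} {d d₁ d₂ : ℝ} {y : Coord n}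

theorem congr_deriv (hf : HasPartialD h f d₁ y) (e : d₁ = d₂) : HasPartialD h f d₂ y := e ▸ hf

theorem congr_of_eventuallyEq (hf : HasPartialD h f₁ d y) (e : f₂ =ᶠ[nhds y] f₁) :
    HasPartialD h f₂ d y :=
  ⟨hf.1.congr_of_eventuallyEq e, by rw [← hf.2, partialD, partialD, e.fderiv_eq]⟩

/-- The slit space is open, so an identity known at every nonzero vector may be differentiated at a
nonzero vector. This is how formulas are differentiated repeatedly below. -/
theorem congr_of_ne_zero (hf : HasPartialD h f₁ d y) (hy : y ≠ 0)
    (e : ∀ z, z ≠ 0 → f₂ z = f₁ z) : HasPartialD h f₂ d y :=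
  hf.congr_of_eventuallyEq (Filter.eventually_of_mem (isOpen_ne.mem_nhds hy) e)

theorem const (c : ℝ) : HasPartialD h (fun _ => c) 0 y :=
  ⟨differentiableAt_const c, by simp [partialD]⟩

theorem add (h₁ : HasPartialD h f₁ d₁ y) (h₂ : HasPartialD h f₂ d₂ y) :
    HasPartialD h (fun z => f₁ z + f₂ z) (d₁ + d₂) y :=
  ⟨h₁.1.add h₂.1, by rw [← h₁.2, ← h₂.2, partialD, fderiv_fun_add h₁.1 h₂.1]; rfl⟩

theorem sub (h₁ : HasPartialD h f₁ d₁ y) (h₂ : HasPartialD h f₂ d₂ y) :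
    HasPartialD h (fun z => f₁ z - f₂ z) (d₁ - d₂) y :=
  ⟨h₁.1.sub h₂.1, by rw [← h₁.2, ← h₂.2, partialD, fderiv_fun_sub h₁.1 h₂.1]; rfl⟩

theorem mul (h₁ : HasPartialD h f₁ d₁ y) (h₂ : HasPartialD h f₂ d₂ y) :
    HasPartialD h (fun z => f₁ z * f₂ z) (d₁ * f₂ y + f₁ y * d₂) y :=
  ⟨h₁.1.mul h₂.1, by
    rw [← h₁.2, ← h₂.2, partialD, fderiv_fun_mul h₁.1 h₂.1]
    simp [partialD]; ring⟩

theorem const_mul (c : ℝ) (hf : HasPartialD h f d y) : HasPartialD h (fun z => c * f z) (c * d) y :=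
  ((const c).mul hf).congr_deriv (by ring)

theorem sum {ι : Type*} {s : Finset ι} {f : ι → Coord n → ℝ} {d : ι → ℝ}
    (hf : ∀ a ∈ s, HasPartialD h (f a) (d a) y) :
    HasPartialD h (fun z => ∑ a ∈ s, f a z) (∑ a ∈ s, d a) y :=
  ⟨DifferentiableAt.fun_sum fun a ha => (hf a ha).1, by
    rw [partialD, fderiv_fun_sum fun a ha => (hf a ha).1, sum_apply]
    exact Finset.sum_congr rfl fun a ha => (hf a ha).2⟩

theorem coord (j : Fin n) : HasPartialD h (fun z => z j) (if j = h then 1 else 0) y := by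
  have e : HasFDerivAt (fun z : Coord n => z j) (EuclideanSpace.proj j : Coord n →L[ℝ] ℝ) y :=
    (EuclideanSpace.proj j : Coord n →L[ℝ] ℝ).hasFDerivAt
  refine ⟨e.differentiableAt, ?_⟩
  rw [partialD, e.fderiv]
  simp

/-- Computing one derivative in two ways yields an identity; the Euler relations and the symmetries
of C arise like this. -/
theorem unique (h₁ : HasPartialD h f d₁ y) (h₂ : HasPartialD h f d₂ y) : d₁ = d₂ :=
  h₁.2.symm.trans h₂.2

end HasPartialD

/-- No differentiability is needed: a nonzero scalar preserves non-differentiability, where both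
sides take the default value 0, and for c = 0 both sides vanish. -/
theorem partialD_const_mul (h : Fin n) (c : ℝ) (f : Coord n → ℝ) (y : Coord n) :
    partialD h (fun z => c * f z) y = c * partialD h f y := by
  rw [partialD, show (fun z => c * f z) = c • f from rfl, fderiv_const_smul_field]; rfl

theorem _root_.ContDiffOn.partialD {f : Coord n → ℝ} {s : Set (Coord n)} (hs : IsOpen s)
    (hf : ContDiffOn ℝ ∞ f s) (h : Fin n) : ContDiffOn ℝ ∞ (partialD h f) s :=
  (hf.fderiv_of_isOpen hs le_rfl).clm_apply contDiffOn_const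

theorem hasPartialD_of_contDiffOn {f : Coord n → ℝ} (hf : ContDiffOn ℝ ∞ f {0}ᶜ) (h : Fin n)
    {y : Coord n} (hy : y ≠ 0) : HasPartialD h f (partialD h f y) y :=
  ⟨(hf.contDiffAt (isOpen_ne.mem_nhds hy)).differentiableAt (by simp), rfl⟩

theorem partialD_comm {f : Coord n → ℝ} (hf : ContDiffOn ℝ ∞ f {0}ᶜ) (h k : Fin n)
    {y : Coord n} (hy : y ≠ 0) : partialD h (partialD k f) y = partialD k (partialD h f) y := by
  have hc : ContDiffAt ℝ ∞ f y := hf.contDiffAt (isOpen_ne.mem_nhds hy)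
  have hd : DifferentiableAt ℝ (fderiv ℝ f) y :=
    (hc.fderiv_right (m := ∞) le_rfl).differentiableAt (by simp)
  have hsymm : IsSymmSndFDerivAt ℝ f y :=
    hc.isSymmSndFDerivAt (by simpa using WithTop.coe_le_coe.2 (le_top : (2 : ℕ∞) ≤ ⊤))
  have key : ∀ a b : Fin n, partialD a (partialD b f) y
      = fderiv ℝ (fderiv ℝ f) y (EuclideanSpace.single a 1) (EuclideanSpace.single b 1) := by
    intro a b
    change fderiv ℝ (fun z => fderiv ℝ f z (EuclideanSpace.single b 1)) y _ = _
    rw [fderiv_clm_apply hd (differentiableAt_const _)]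
    simp
  rw [key, key, hsymm]

/-! ### Partial derivatives of matrices -/

/-- The entries of `M` have the entries of `D` as partial derivatives at `y`. -/
def HasMatrixPartialD (h : Fin n) (M : Coord n → Matrix (Fin n) (Fin n) ℝ)
    (D : Matrix (Fin n) (Fin n) ℝ) (y : Coord n) : Prop :=
  ∀ a b, HasPartialD h (fun z => M z a b) (D a b) y

namespace HasMatrixPartialD

variable {h : Fin n} {M N : Coord n → Matrix (Fin n) (Fin n) ℝ}
  {D E : Matrix (Fin n) (Fin n) ℝ} {y : Coord n}

theorem mul (hM : HasMatrixPartialD h M D y) (hN : HasMatrixPartialD h N E y) :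
    HasMatrixPartialD h (fun z => M z * N z) (D * N y + M y * E) y := by
  intro a b
  simp only [Matrix.mul_apply, Matrix.add_apply, ← Finset.sum_add_distrib]
  exact HasPartialD.sum fun c _ => (hM a c).mul (hN c b)

theorem congr_deriv (hM : HasMatrixPartialD h M D y) (e : D = E) : HasMatrixPartialD h M E y :=
  e ▸ hM

end HasMatrixPartialD

/-! ### Minkowski norms in coordinates -/

/-- The restriction of `F(x, y)` to the tangent space at `x` is a Minkowski norm. -/
structure IsMinkowskiAt (F : LocalFn n) (x : Coord n) : Prop where
  smooth : ContDiffOn ℝ ∞ (F x) {0}ᶜ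
  pos : ∀ y, y ≠ 0 → 0 < F x y
  homogeneous : ∀ (y : Coord n) (c : ℝ), 0 < c → F x (c • y) = c * F x y
  posDef : ∀ y, y ≠ 0 → (gMatrix F x y).PosDef

/-- The matrix `(C_{abj})_{ab}`. -/
def cMat (F : LocalFn n) (x : Coord n) (j : Fin n) (y : Coord n) : Matrix (Fin n) (Fin n) ℝ :=
  Matrix.of fun a b => C F a b j x y

/-- The matrix `(C_{abjk})_{ab}`. -/
def c4Mat (F : LocalFn n) (x : Coord n) (j k : Fin n) (y : Coord n) :
    Matrix (Fin n) (Fin n) ℝ :=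
  Matrix.of fun a b => C4 F a b j k x y

/-- The matrix `(C_{abjkh})_{ab}`. -/
def c5Mat (F : LocalFn n) (x : Coord n) (j k h : Fin n) (y : Coord n) :
    Matrix (Fin n) (Fin n) ℝ :=
  Matrix.of fun a b => C5 F a b j k h x y

/-- The inverse of the metric tensor, as a function of `y`. -/
def gInvMat (F : LocalFn n) (x y : Coord n) : Matrix (Fin n) (Fin n) ℝ := (gMatrix F x y)⁻¹

theorem contDiffOn_det {E : Type*} [NormedAddCommGroup E] [NormedSpace ℝ E] {s : Set E}
    {m : Type*} [Fintype m] [DecidableEq m]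
    {A : E → Matrix m m ℝ} (hA : ∀ a b, ContDiffOn ℝ ∞ (fun z => A z a b) s) :
    ContDiffOn ℝ ∞ (fun z => (A z).det) s := by
  simp only [Matrix.det_apply]
  exact ContDiffOn.sum fun p _ => (contDiffOn_prod fun i _ => hA _ _).const_smul _

/-- Cramer's rule: the inverse is the adjugate over the determinant, and each adjugate entry is the
determinant of A with one row replaced by a constant. -/
theorem contDiffOn_inv_apply {E : Type*} [NormedAddCommGroup E] [NormedSpace ℝ E] {s : Set E}
    {m : Type*} [Fintype m] [DecidableEq m]
    {A : E → Matrix m m ℝ} (hA : ∀ a b, ContDiffOn ℝ ∞ (fun z => A z a b) s)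
    (hdet : ∀ z ∈ s, (A z).det ≠ 0) (a b : m) : ContDiffOn ℝ ∞ (fun z => (A z)⁻¹ a b) s := by
  simp only [Matrix.inv_def, Matrix.smul_apply, Ring.inverse_eq_inv', smul_eq_mul,
    Matrix.adjugate_apply]
  refine ((contDiffOn_det hA).inv hdet).mul (contDiffOn_det fun c d => ?_)
  simp only [Matrix.updateRow_apply]
  split_ifs
  · exact contDiffOn_const
  · exact hA c d

namespace IsMinkowskiAt

variable {F : LocalFn n} {x y : Coord n}

theorem contDiffOn_sq (hF : IsMinkowskiAt F x) : ContDiffOn ℝ ∞ (sq F x) {0}ᶜ := hF.smooth.pow 2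

theorem contDiffOn_dotD_sq (hF : IsMinkowskiAt F x) (i : Fin n) :
    ContDiffOn ℝ ∞ (dotD i (sq F) x) {0}ᶜ := hF.contDiffOn_sq.partialD isOpen_compl_singleton i

theorem contDiffOn_g (hF : IsMinkowskiAt F x) (i j : Fin n) : ContDiffOn ℝ ∞ (g F i j x) {0}ᶜ :=
  contDiffOn_const.mul ((hF.contDiffOn_dotD_sq j).partialD isOpen_compl_singleton i)

theorem contDiffOn_C (hF : IsMinkowskiAt F x) (i j k : Fin n) :
    ContDiffOn ℝ ∞ (C F i j k x) {0}ᶜ :=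
  contDiffOn_const.mul ((hF.contDiffOn_g i j).partialD isOpen_compl_singleton k)

theorem contDiffOn_C4 (hF : IsMinkowskiAt F x) (i j k h : Fin n) :
    ContDiffOn ℝ ∞ (C4 F i j k h x) {0}ᶜ := (hF.contDiffOn_C i j k).partialD isOpen_compl_singleton h

theorem contDiffOn_gInv (hF : IsMinkowskiAt F x) (i j : Fin n) :
    ContDiffOn ℝ ∞ (gInv F i j x) {0}ᶜ :=
  contDiffOn_inv_apply (A := gMatrix F x) (fun a b => hF.contDiffOn_g a b)
    (fun z hz => (hF.posDef z hz).det_pos.ne') i j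

theorem hasPartialD_F (hF : IsMinkowskiAt F x) (hy : y ≠ 0) (h : Fin n) :
    HasPartialD h (F x) (ell F h x y) y := hasPartialD_of_contDiffOn hF.smooth h hy

theorem hasPartialD_g (hF : IsMinkowskiAt F x) (hy : y ≠ 0) (i j h : Fin n) :
    HasPartialD h (g F i j x) (2 * C F i j h x y) y :=
  (hasPartialD_of_contDiffOn (hF.contDiffOn_g i j) h hy).congr_deriv (by simp [C, dotD])

theorem hasPartialD_C (hF : IsMinkowskiAt F x) (hy : y ≠ 0) (i j k h : Fin n) :
    HasPartialD h (C F i j k x) (C4 F i j k h x y) y :=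
  hasPartialD_of_contDiffOn (hF.contDiffOn_C i j k) h hy

theorem hasPartialD_C4 (hF : IsMinkowskiAt F x) (hy : y ≠ 0) (i j k l h : Fin n) :
    HasPartialD h (C4 F i j k l x) (C5 F i j k l h x y) y :=
  hasPartialD_of_contDiffOn (hF.contDiffOn_C4 i j k l) h hy

theorem hasPartialD_dotD_sq (hF : IsMinkowskiAt F x) (hy : y ≠ 0) (i h : Fin n) :
    HasPartialD h (dotD i (sq F) x) (2 * g F h i x y) y :=
  (hasPartialD_of_contDiffOn (hF.contDiffOn_dotD_sq i) h hy).congr_deriv (by simp [g, dotD])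

theorem dotD_sq (hF : IsMinkowskiAt F x) (hy : y ≠ 0) (h : Fin n) :
    dotD h (sq F) x y = 2 * (F x y * ell F h x y) := by
  have h₁ := (hF.hasPartialD_F hy h).mul (hF.hasPartialD_F hy h)
  have h₂ : HasPartialD h (sq F x) _ y := hasPartialD_of_contDiffOn hF.contDiffOn_sq h hy
  have e : sq F x = fun z => F x z * F x z := by funext z; simp [sq, pow_two]
  rw [← e] at h₁
  rw [dotD, h₂.unique h₁]; ring

theorem hasPartialD_sq (hF : IsMinkowskiAt F x) (hy : y ≠ 0) (h : Fin n) :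
    HasPartialD h (sq F x) (2 * (F x y * ell F h x y)) y :=
  (hasPartialD_of_contDiffOn hF.contDiffOn_sq h hy).congr_deriv (hF.dotD_sq hy h)

/-! ### Symmetries -/

theorem g_comm (hF : IsMinkowskiAt F x) (hy : y ≠ 0) (i j : Fin n) : g F i j x y = g F j i x y := by
  have := partialD_comm hF.contDiffOn_sq i j hy
  exact congrArg ((1 / 2) * ·) this

theorem C_comm₁₂ (hF : IsMinkowskiAt F x) (hy : y ≠ 0) (i j k : Fin n) :
    C F i j k x y = C F j i k x y := by
  have := (hF.hasPartialD_g hy i j k).unique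
    ((hF.hasPartialD_g hy j i k).congr_of_ne_zero hy fun z hz => hF.g_comm hz i j)
  linarith

/-- With the middle index innermost, C_{ajb} = ¼ ∂̇_b ∂̇_a ∂̇_j F², so exchanging the two outer
derivatives exchanges the first and third index. -/
theorem C_comm₁₃ (hF : IsMinkowskiAt F x) (hy : y ≠ 0) (i j k : Fin n) :
    C F i j k x y = C F k j i x y := by
  have h := partialD_comm (hF.contDiffOn_dotD_sq j) k i hy
  have key : ∀ a b, C F a j b x y = (1 / 4) * partialD b (partialD a (dotD j (sq F) x)) y := by
    intro a b
    have : g F a j x = fun z => (1 / 2) * partialD a (dotD j (sq F) x) z := rfl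
    rw [C, dotD, this, partialD_const_mul]; ring
  rw [key, key, h]

theorem C_comm₂₃ (hF : IsMinkowskiAt F x) (hy : y ≠ 0) (i j k : Fin n) :
    C F i j k x y = C F i k j x y := by
  rw [hF.C_comm₁₂ hy i j, hF.C_comm₁₃ hy j i, hF.C_comm₁₂ hy k i]

theorem C4_comm₁₂ (hF : IsMinkowskiAt F x) (hy : y ≠ 0) (i j k h : Fin n) :
    C4 F i j k h x y = C4 F j i k h x y :=
  (hF.hasPartialD_C hy i j k h).unique
    ((hF.hasPartialD_C hy j i k h).congr_of_ne_zero hy fun _ hz => hF.C_comm₁₂ hz i j k)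

theorem C4_comm₂₃ (hF : IsMinkowskiAt F x) (hy : y ≠ 0) (i j k h : Fin n) :
    C4 F i j k h x y = C4 F i k j h x y :=
  (hF.hasPartialD_C hy i j k h).unique
    ((hF.hasPartialD_C hy i k j h).congr_of_ne_zero hy fun _ hz => hF.C_comm₂₃ hz i j k)

theorem C4_comm₃₄ (hF : IsMinkowskiAt F x) (hy : y ≠ 0) (i j k h : Fin n) :
    C4 F i j k h x y = C4 F i j h k x y := by
  have key : ∀ a b, C4 F i j a b x y = (1 / 2) * partialD b (partialD a (g F i j x)) y := by
    intro a b
    have : C F i j a x = fun z => (1 / 2) * partialD a (g F i j x) z := rfl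
    rw [C4, dotD, this, partialD_const_mul]
  rw [key, key, partialD_comm (hF.contDiffOn_g i j) h k hy]

/-! ### Consequences of homogeneity -/

/-- Euler's theorem: t ↦ F(ty) is differentiated at t = 1 by the chain rule and by homogeneity. -/
theorem sum_ell_mul (hF : IsMinkowskiAt F x) (hy : y ≠ 0) : ∑ a, ell F a x y * y a = F x y := by
  have hd : DifferentiableAt ℝ (F x) y :=
    (hF.smooth.contDiffAt (isOpen_ne.mem_nhds hy)).differentiableAt (by simp)
  have h₁ : HasDerivAt (fun t : ℝ => F x (t • y)) (fderiv ℝ (F x) y y) 1 := by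
    have hc : HasDerivAt (fun t : ℝ => t • y) y 1 := by
      simpa using (hasDerivAt_id (1 : ℝ)).smul_const y
    exact HasFDerivAt.comp_hasDerivAt 1 (by simpa using hd.hasFDerivAt) hc
  have h₂ : HasDerivAt (fun t : ℝ => F x (t • y)) (F x y) 1 := by
    have hc : HasDerivAt (fun t : ℝ => t * F x y) (F x y) 1 := by
      simpa using (hasDerivAt_id (1 : ℝ)).mul_const (F x y)
    -- Homogeneity is available for t > 0 only, which suffices near t = 1.
    exact hc.congr_of_eventuallyEq (Filter.eventually_of_mem (lt_mem_nhds one_pos)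
      fun t ht => hF.homogeneous y t ht)
  have hy' : y = ∑ a, y a • EuclideanSpace.single a (1 : ℝ) := by
    ext b
    simp [Finset.sum_apply, Pi.single_apply]
  rw [← h₁.unique h₂]
  conv_rhs => rw [show fderiv ℝ (F x) y y
    = fderiv ℝ (F x) y (∑ a, y a • EuclideanSpace.single a (1 : ℝ)) from by rw [← hy']]
  rw [map_sum]
  exact Finset.sum_congr rfl fun a _ => by rw [map_smul, smul_eq_mul, mul_comm]; rfl

theorem hasPartialD_F_mul_ell (hF : IsMinkowskiAt F x) (hy : y ≠ 0) (i h : Fin n) :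
    HasPartialD h (fun z => F x z * ell F i x z) (g F h i x y) y :=
  (((hF.hasPartialD_dotD_sq hy i h).const_mul (1 / 2)).congr_of_ne_zero hy fun z hz => by
    rw [hF.dotD_sq hz]; ring).congr_deriv (by ring)

/-- The derivative of Fℓ_i is g_{hi}, hence F ∂̇_h ℓ_i = g_{hi} − ℓ_h ℓ_i. -/
theorem hasPartialD_ell (hF : IsMinkowskiAt F x) (hy : y ≠ 0) (i h : Fin n) :
    HasPartialD h (ell F i x) (ang F h i x y / F x y) y := by
  have hs : HasPartialD h (ell F i x) _ y :=
    hasPartialD_of_contDiffOn (hF.smooth.partialD isOpen_compl_singleton i) h hy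
  have := ((hF.hasPartialD_F hy h).mul hs).unique (hF.hasPartialD_F_mul_ell hy i h)
  refine hs.congr_deriv ?_
  rw [eq_div_iff (hF.pos y hy).ne', ang]
  linarith

/-- Differentiating Σ Fℓ_a y^a = F² along y^i gives g_{ia} y^a + Fℓ_i = 2Fℓ_i. -/
theorem sum_g_mul (hF : IsMinkowskiAt F x) (hy : y ≠ 0) (i : Fin n) :
    ∑ a, g F i a x y * y a = F x y * ell F i x y := by
  have h₁ : HasPartialD i (fun z => ∑ a, F x z * ell F a x z * z a) _ y :=
    HasPartialD.sum fun a _ => (hF.hasPartialD_F_mul_ell hy a i).mul (HasPartialD.coord a)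
  have h₂ := (hF.hasPartialD_sq hy i).congr_of_ne_zero hy
    (f₂ := fun z => ∑ a, F x z * ell F a x z * z a) fun z hz => by
      simp only [mul_assoc, ← Finset.mul_sum, hF.sum_ell_mul hz, sq, pow_two]
  have := h₁.unique h₂
  rw [Finset.sum_add_distrib] at this
  simp at this
  linarith

/-- Differentiating g_{ia} y^a = Fℓ_i along y^j leaves 2 C_{iaj} y^a + g_{ij} = g_{ji}. -/
theorem sum_C_mul (hF : IsMinkowskiAt F x) (hy : y ≠ 0) (i j : Fin n) :
    ∑ a, C F i a j x y * y a = 0 := by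
  have h₁ : HasPartialD j (fun z => ∑ a, g F i a x z * z a) _ y :=
    HasPartialD.sum fun a _ => (hF.hasPartialD_g hy i a j).mul (HasPartialD.coord a)
  have h₂ := (hF.hasPartialD_F_mul_ell hy i j).congr_of_ne_zero hy fun z hz => hF.sum_g_mul hz i
  have := h₁.unique h₂
  rw [Finset.sum_add_distrib] at this
  simp [hF.g_comm hy i j, mul_assoc, ← Finset.mul_sum] at this
  exact this

/-! ### The inverse metric -/

theorem gInvMat_mul (hF : IsMinkowskiAt F x) (hy : y ≠ 0) : gInvMat F x y * gMatrix F x y = 1 :=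
  Matrix.nonsing_inv_mul _ (hF.posDef y hy).det_pos.ne'.isUnit

theorem mul_gInvMat (hF : IsMinkowskiAt F x) (hy : y ≠ 0) : gMatrix F x y * gInvMat F x y = 1 :=
  Matrix.mul_nonsing_inv _ (hF.posDef y hy).det_pos.ne'.isUnit

theorem gInvMat_transpose (hF : IsMinkowskiAt F x) (hy : y ≠ 0) :
    (gInvMat F x y).transpose = gInvMat F x y := by
  rw [gInvMat, Matrix.transpose_nonsing_inv]
  congr 1
  ext i j
  exact hF.g_comm hy j i

theorem hasMatrixPartialD_gInvMat (hF : IsMinkowskiAt F x) (hy : y ≠ 0) (h : Fin n) :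
    HasMatrixPartialD h (gInvMat F x)
      (-(2 : ℝ) • (gInvMat F x y * cMat F x h y * gInvMat F x y)) y := by
  set D : Matrix (Fin n) (Fin n) ℝ := Matrix.of fun a b => partialD h (gInv F a b x) y
  have hD : HasMatrixPartialD h (gInvMat F x) D y := fun a b =>
    hasPartialD_of_contDiffOn (hF.contDiffOn_gInv a b) h hy
  have hg : HasMatrixPartialD h (gMatrix F x) ((2 : ℝ) • cMat F x h y) y := fun a b =>
    hF.hasPartialD_g hy a b h
  -- The inverse is already known to be smooth, so g^{-1} g = 1 can be differentiated and solved for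
  -- D.
  have e : D * gMatrix F x y + gInvMat F x y * ((2 : ℝ) • cMat F x h y) = 0 := by
    ext a b
    refine (hD.mul hg a b).unique ((HasPartialD.const ((1 : Matrix (Fin n) (Fin n) ℝ) a b)
      ).congr_of_ne_zero hy fun z hz => congrFun (congrFun (hF.gInvMat_mul hz) a) b)
  refine hD.congr_deriv ?_
  have e' := congrArg (· * gInvMat F x y) e
  simp only [add_mul, mul_assoc, hF.mul_gInvMat hy, mul_one, zero_mul] at e'
  rw [eq_neg_of_add_eq_zero_left e']
  simp [mul_assoc]

theorem hasMatrixPartialD_cMat (hF : IsMinkowskiAt F x) (hy : y ≠ 0) (j h : Fin n) :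
    HasMatrixPartialD h (cMat F x j) (c4Mat F x j h y) y := fun a b => hF.hasPartialD_C hy a b j h

theorem hasMatrixPartialD_c4Mat (hF : IsMinkowskiAt F x) (hy : y ≠ 0) (j k h : Fin n) :
    HasMatrixPartialD h (c4Mat F x j k) (c5Mat F x j k h y) y :=
  fun a b => hF.hasPartialD_C4 hy a b j k h

theorem cMat_transpose (hF : IsMinkowskiAt F x) (hy : y ≠ 0) (j : Fin n) :
    (cMat F x j y).transpose = cMat F x j y := by
  ext a b; exact hF.C_comm₁₂ hy b a j

theorem c4Mat_transpose (hF : IsMinkowskiAt F x) (hy : y ≠ 0) (j k : Fin n) :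
    (c4Mat F x j k y).transpose = c4Mat F x j k y := by
  ext a b; exact hF.C4_comm₁₂ hy b a j k

theorem F_mul_ellU (hF : IsMinkowskiAt F x) (hy : y ≠ 0) (i : Fin n) :
    F x y * ellU F i x y = y i := by
  have : (gInvMat F x y).mulVec ((gMatrix F x y).mulVec y.ofLp) = y.ofLp := by
    rw [Matrix.mulVec_mulVec, hF.gInvMat_mul hy, Matrix.one_mulVec]
  rw [← congrFun this i, ellU, Finset.mul_sum]
  refine Finset.sum_congr rfl fun a _ => ?_
  have := hF.sum_g_mul hy a
  change _ = gInv F i a x y * ∑ b, g F a b x y * y b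
  rw [this]; ring

theorem sum_C_mul_ellU (hF : IsMinkowskiAt F x) (hy : y ≠ 0) (i j : Fin n) :
    ∑ a, C F i a j x y * ellU F a x y = 0 := by
  have h := hF.sum_C_mul hy i j
  simp only [← hF.F_mul_ellU hy, mul_left_comm _ (F x y), ← Finset.mul_sum] at h
  exact (mul_eq_zero.1 h).resolve_left (hF.pos y hy).ne'

end IsMinkowskiAt

/-! ### Raising both indices of a matrix -/

/-- The matrix `g^{ia} g^{rb} M_{ab}` (for symmetric `g`). -/
def raise (F : LocalFn n) (x y : Coord n) (M : Matrix (Fin n) (Fin n) ℝ) :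
    Matrix (Fin n) (Fin n) ℝ := gInvMat F x y * M * gInvMat F x y

theorem raise_add (F : LocalFn n) (x y : Coord n) (M N : Matrix (Fin n) (Fin n) ℝ) :
    raise F x y (M + N) = raise F x y M + raise F x y N := by
  simp [raise, mul_add, add_mul]

theorem raise_sub (F : LocalFn n) (x y : Coord n) (M N : Matrix (Fin n) (Fin n) ℝ) :
    raise F x y (M - N) = raise F x y M - raise F x y N := by
  simp [raise, mul_sub, sub_mul]

theorem raise_smul (F : LocalFn n) (x y : Coord n) (c : ℝ) (M : Matrix (Fin n) (Fin n) ℝ) :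
    raise F x y (c • M) = c • raise F x y M := by
  simp [raise]

/-- `M_{at} g^{ts} N_{sb}`. -/
def contr (F : LocalFn n) (x y : Coord n) (M N : Matrix (Fin n) (Fin n) ℝ) :
    Matrix (Fin n) (Fin n) ℝ := M * gInvMat F x y * N

theorem contr_assoc (F : LocalFn n) (x y : Coord n) (M N P : Matrix (Fin n) (Fin n) ℝ) :
    contr F x y (contr F x y M N) P = contr F x y M (contr F x y N P) := by
  simp [contr, mul_assoc]

namespace IsMinkowskiAt

variable {F : LocalFn n} {x y : Coord n}

theorem gInv_comm (hF : IsMinkowskiAt F x) (hy : y ≠ 0) (i j : Fin n) :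
    gInv F i j x y = gInv F j i x y :=
  (congrFun (congrFun (hF.gInvMat_transpose hy) i) j).symm

theorem raise_apply (hF : IsMinkowskiAt F x) (hy : y ≠ 0) (M : Matrix (Fin n) (Fin n) ℝ)
    (i r : Fin n) :
    raise F x y M i r = ∑ a, ∑ b, gInv F i a x y * gInv F r b x y * M a b := by
  rw [raise, Matrix.mul_apply, Finset.sum_comm' (t' := Finset.univ) (s' := fun _ => Finset.univ)
    (by simp)]
  refine Finset.sum_congr rfl fun b _ => ?_
  rw [Matrix.mul_apply, Finset.sum_mul]
  refine Finset.sum_congr rfl fun a _ => ?_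
  rw [hF.gInv_comm hy r b]
  change gInv F i a x y * M a b * gInv F b r x y = _
  ring

theorem raise_transpose (hF : IsMinkowskiAt F x) (hy : y ≠ 0) (M : Matrix (Fin n) (Fin n) ℝ) :
    (raise F x y M).transpose = raise F x y M.transpose := by
  simp [raise, Matrix.transpose_mul, hF.gInvMat_transpose hy, mul_assoc]

theorem contr_transpose (hF : IsMinkowskiAt F x) (hy : y ≠ 0) (M N : Matrix (Fin n) (Fin n) ℝ) :
    (contr F x y M N).transpose = contr F x y N.transpose M.transpose := by
  simp [contr, Matrix.transpose_mul, hF.gInvMat_transpose hy, mul_assoc]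

/-- Used to bring every term to the index order (i, r). It transposes the inner matrix, which
reverses products formed with `contr`. -/
theorem raise_comm (hF : IsMinkowskiAt F x) (hy : y ≠ 0) (M : Matrix (Fin n) (Fin n) ℝ)
    (i r : Fin n) : raise F x y M r i = raise F x y M.transpose i r := by
  rw [← hF.raise_transpose hy]; rfl

/-! ### The Cartan tensors with raised indices as matrix entries. -/

theorem CU_eq (hF : IsMinkowskiAt F x) (hy : y ≠ 0) (r q j : Fin n) :
    CU F r q j x y = (gInvMat F x y * cMat F x j y) r q := by
  rw [CU, Matrix.mul_apply]
  refine Finset.sum_congr rfl fun a _ => ?_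
  rw [hF.gInv_comm hy a r, hF.C_comm₁₃ hy, hF.C_comm₂₃ hy, mul_comm]; rfl

theorem CU_comm (hF : IsMinkowskiAt F x) (hy : y ≠ 0) (r q j : Fin n) :
    CU F r q j x y = CU F r j q x y :=
  Finset.sum_congr rfl fun a _ => by rw [hF.C_comm₁₂ hy]

theorem CUU_eq (hF : IsMinkowskiAt F x) (hy : y ≠ 0) (i r j : Fin n) :
    CUU F i r j x y = raise F x y (cMat F x j y) i r := (hF.raise_apply hy _ i r).symm

theorem CUU_comm (hF : IsMinkowskiAt F x) (hy : y ≠ 0) (i r j : Fin n) :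
    CUU F i r j x y = CUU F r i j x y := by
  rw [hF.CUU_eq hy, hF.CUU_eq hy, hF.raise_comm hy, hF.cMat_transpose hy]

theorem C4UU_eq (hF : IsMinkowskiAt F x) (hy : y ≠ 0) (i r j k : Fin n) :
    C4UU F i r j k x y = raise F x y (c4Mat F x j k y) i r := (hF.raise_apply hy _ i r).symm

theorem C5UU_eq (hF : IsMinkowskiAt F x) (hy : y ≠ 0) (i r j k h : Fin n) :
    C5UU F i r j k h x y = raise F x y (c5Mat F x j k h y) i r := (hF.raise_apply hy _ i r).symm

theorem C4U_eq (F : LocalFn n) (x y : Coord n) (r q j k : Fin n) :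
    C4U F r q j k x y = (gInvMat F x y * c4Mat F x j k y) r q := rfl

theorem sum_gInvMat_mul_raise (M N : Matrix (Fin n) (Fin n) ℝ) (r i : Fin n) :
    ∑ q, (gInvMat F x y * M) r q * raise F x y N q i = raise F x y (contr F x y M N) r i := by
  rw [← Matrix.mul_apply]
  simp [raise, contr, mul_assoc]

theorem sum_CU_mul_CUU (hF : IsMinkowskiAt F x) (hy : y ≠ 0) (i r j k : Fin n) :
    ∑ q, CU F r q j x y * CUU F q i k x y
      = raise F x y (contr F x y (cMat F x j y) (cMat F x k y)) r i := by
  simp only [hF.CU_eq hy, hF.CUU_eq hy, sum_gInvMat_mul_raise]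

theorem sum_C4U_mul_CUU (hF : IsMinkowskiAt F x) (hy : y ≠ 0) (i r j k h : Fin n) :
    ∑ q, C4U F r q j k x y * CUU F q i h x y
      = raise F x y (contr F x y (c4Mat F x j k y) (cMat F x h y)) r i := by
  simp only [C4U_eq, hF.CUU_eq hy, sum_gInvMat_mul_raise]

theorem sum_sum_C_mul_CUU (hF : IsMinkowskiAt F x) (hy : y ≠ 0) (i r j k h : Fin n) :
    ∑ q, (∑ t, C F q t j x y * CUU F t i k x y) * CUU F q r h x y
      = raise F x y (contr F x y (cMat F x h y) (contr F x y (cMat F x j y) (cMat F x k y))) r i := by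
  have : ∀ q, (∑ t, C F q t j x y * CUU F t i k x y) * CUU F q r h x y
      = raise F x y (cMat F x h y) r q * (cMat F x j y * raise F x y (cMat F x k y)) q i := by
    intro q
    rw [hF.CUU_comm hy q r, hF.CUU_eq hy, mul_comm, Matrix.mul_apply]
    simp only [hF.CUU_eq hy]; rfl
  simp only [this, ← Matrix.mul_apply]
  simp [raise, contr, mul_assoc]

theorem sum_sum_C_mul_CUU' (hF : IsMinkowskiAt F x) (hy : y ≠ 0) (i r j k h : Fin n) :
    ∑ q, (∑ t, C F q t j x y * CUU F i t k x y) * CUU F q r h x y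
      = raise F x y (contr F x y (cMat F x h y) (contr F x y (cMat F x j y) (cMat F x k y))) r i := by
  simp only [← hF.sum_sum_C_mul_CUU hy, fun t => hF.CUU_comm hy i t k]

theorem hasMatrixPartialD_gInvMat_raise (hF : IsMinkowskiAt F x) (hy : y ≠ 0) (h : Fin n) :
    HasMatrixPartialD h (gInvMat F x) (-(2 : ℝ) • raise F x y (cMat F x h y)) y :=
  hF.hasMatrixPartialD_gInvMat hy h

/-- Each of the two copies of g^{-1} contributes −2 g^{-1} C_h g^{-1}, so the derivative is again a
raised matrix, with one correction on either side of M. -/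
theorem hasMatrixPartialD_raise (hF : IsMinkowskiAt F x) (hy : y ≠ 0) {h : Fin n}
    {M : Coord n → Matrix (Fin n) (Fin n) ℝ} {D : Matrix (Fin n) (Fin n) ℝ}
    (hM : HasMatrixPartialD h M D y) :
    HasMatrixPartialD h (fun z => raise F x z (M z))
      (raise F x y (D - (2 : ℝ) • contr F x y (cMat F x h y) (M y)
        - (2 : ℝ) • contr F x y (M y) (cMat F x h y))) y := by
  have hG := hF.hasMatrixPartialD_gInvMat hy h
  refine ((hG.mul hM).mul hG).congr_deriv ?_
  simp only [raise, contr, mul_sub, sub_mul, add_mul, Matrix.smul_mul, Matrix.mul_smul,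
    mul_assoc, neg_smul, neg_mul, mul_neg]
  abel

theorem hasMatrixPartialD_contr (hF : IsMinkowskiAt F x) (hy : y ≠ 0) {h : Fin n}
    {M N : Coord n → Matrix (Fin n) (Fin n) ℝ} {D E : Matrix (Fin n) (Fin n) ℝ}
    (hM : HasMatrixPartialD h M D y) (hN : HasMatrixPartialD h N E y) :
    HasMatrixPartialD h (fun z => contr F x z (M z) (N z))
      (contr F x y D (N y) + contr F x y (M y) E
        - (2 : ℝ) • contr F x y (M y) (contr F x y (cMat F x h y) (N y))) y := by
  have hG := hF.hasMatrixPartialD_gInvMat hy h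
  refine ((hM.mul hG).mul hN).congr_deriv ?_
  simp only [contr, add_mul, Matrix.smul_mul, Matrix.mul_smul,
    mul_assoc, neg_smul, neg_mul, mul_neg]
  abel

/-! ### The third derivative of `F² g^{ir}` -/

theorem hasPartialD_sq_mul_gInv (hF : IsMinkowskiAt F x) (hy : y ≠ 0) (i r j : Fin n) :
    HasPartialD j (fun z => sq F x z * gInv F i r x z)
      (2 * (F x y * ell F j x y * gInv F i r x y
        - sq F x y * raise F x y (cMat F x j y) i r)) y :=
  ((hF.hasPartialD_sq hy j).mul (hF.hasMatrixPartialD_gInvMat_raise hy j i r)).congr_deriv (by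
    simp only [Matrix.smul_apply, smul_eq_mul]
    change _ * gInv F i r x y + _ = _
    ring)

theorem hasPartialD₂_sq_mul_gInv (hF : IsMinkowskiAt F x) (hy : y ≠ 0) (i r j k : Fin n) :
    HasPartialD k (dotD j (fun x z => sq F x z * gInv F i r x z) x)
      (2 * (g F k j x y * gInv F i r x y
        - 2 * (F x y * ell F j x y * raise F x y (cMat F x k y) i r)
        - 2 * (F x y * ell F k x y * raise F x y (cMat F x j y) i r)
        - sq F x y * (raise F x y (c4Mat F x j k y) i r
          - 2 * raise F x y (contr F x y (cMat F x k y) (cMat F x j y)) i r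
          - 2 * raise F x y (contr F x y (cMat F x j y) (cMat F x k y)) i r))) y := by
  refine HasPartialD.congr_of_ne_zero ?_ hy fun z hz => (hF.hasPartialD_sq_mul_gInv hz i r j).2
  refine ((((hF.hasPartialD_F_mul_ell hy j k).mul (hF.hasMatrixPartialD_gInvMat_raise hy k i r)).sub
    ((hF.hasPartialD_sq hy k).mul (hF.hasMatrixPartialD_raise hy
      (hF.hasMatrixPartialD_cMat hy j k) i r))).const_mul 2).congr_deriv ?_
  simp only [raise_sub, raise_smul, Matrix.smul_apply, Matrix.sub_apply, smul_eq_mul]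
  change 2 * (_ * gInv F i r x y + _ - _) = _
  ring

/-- The overall factor −2 cancels the −½ of the spray formula. The cubic terms are the products of
C_j, C_k, C_h in all six orders. -/
theorem hasPartialD₃_sq_mul_gInv (hF : IsMinkowskiAt F x) (hy : y ≠ 0) (i r j k h : Fin n) :
    HasPartialD h (dotD k (dotD j (fun x z => sq F x z * gInv F i r x z)) x)
      (-2 * (
        F x y ^ 2 * C5UU F i r j k h x y
        + 2 * (CUU F i r j x y * g F k h x y + CUU F i r h x y * g F j k x y
            + CUU F i r k x y * g F j h x y)
        - 2 * gInv F i r x y * C F j k h x y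
        + 2 * F x y * (C4UU F i r j k x y * ell F h x y + C4UU F i r h j x y * ell F k x y
            + C4UU F i r k h x y * ell F j x y)
        - 4 * F x y * (∑ q,
            ((CU F r q j x y * CUU F q i k x y + CU F i q j x y * CUU F q r k x y) * ell F h x y
            + (CU F r q j x y * CUU F q i h x y + CU F i q j x y * CUU F q r h x y) * ell F k x y
            + (CU F r q k x y * CUU F q i h x y + CU F i q k x y * CUU F q r h x y) * ell F j x y))
        - 2 * F x y ^ 2 * (∑ q,
            ((C4U F r q j k x y * CUU F q i h x y + C4U F i q j k x y * CUU F q r h x y)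
            + (C4U F r q j h x y * CUU F q i k x y + C4U F i q j h x y * CUU F q r k x y)
            + (C4U F r q k h x y * CUU F q i j x y + C4U F i q k h x y * CUU F q r j x y)))
        + 4 * F x y ^ 2 * (∑ q, ∑ t,
            ((C F q t j x y * CUU F t i k x y + C F q t k x y * CUU F t i j x y) * CUU F q r h x y
            + (C F q t j x y * CUU F i t h x y + C F q t h x y * CUU F i t j x y) * CUU F q r k x y
            + (C F q t k x y * CUU F i t h x y + C F q t h x y * CUU F i t k x y)
                * CUU F q r j x y)))) y := by
  refine HasPartialD.congr_of_ne_zero ?_ hy fun z hz => (hF.hasPartialD₂_sq_mul_gInv hz i r j k).2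
  have hC := fun j => hF.hasMatrixPartialD_cMat hy j h
  have hr := fun j => hF.hasMatrixPartialD_raise hy (hC j) i r
  have hrr := fun j k => hF.hasMatrixPartialD_raise hy
    (hF.hasMatrixPartialD_contr hy (hC j) (hC k)) i r
  have hr4 := hF.hasMatrixPartialD_raise hy (hF.hasMatrixPartialD_c4Mat hy j k h) i r
  refine ((((((hF.hasPartialD_g hy k j h).mul (hF.hasMatrixPartialD_gInvMat_raise hy h i r)).sub
    (((hF.hasPartialD_F_mul_ell hy j h).mul (hr k)).const_mul 2)).sub
    (((hF.hasPartialD_F_mul_ell hy k h).mul (hr j)).const_mul 2)).sub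
    ((hF.hasPartialD_sq hy h).mul ((hr4.sub ((hrr k j).const_mul 2)).sub
      ((hrr j k).const_mul 2)))).const_mul 2).congr_deriv ?_
  simp only [add_mul, Finset.sum_add_distrib, ← Finset.sum_mul,
    hF.sum_CU_mul_CUU hy, hF.sum_C4U_mul_CUU hy, hF.sum_sum_C_mul_CUU hy, hF.sum_sum_C_mul_CUU' hy]
  -- Everything becomes an (i, r) entry of a raised product associated to the right; only the
  -- symmetries of g, C and C4 used below are then missing.
  simp only [hF.CUU_eq hy, hF.C4UU_eq hy, hF.C5UU_eq hy, hF.raise_comm hy _ i r,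
    hF.contr_transpose hy, hF.cMat_transpose hy, hF.c4Mat_transpose hy, contr_assoc,
    raise_sub, raise_add, raise_smul, Matrix.smul_apply, Matrix.sub_apply, Matrix.add_apply,
    smul_eq_mul, sq]
  change 2 * (_ * gInv F i r x y + _ - _ - _ - _) = _
  rw [hF.g_comm hy h k, hF.g_comm hy h j, hF.g_comm hy k j, hF.C_comm₁₂ hy k j]
  rw [show c4Mat F x h j y = c4Mat F x j h y from Matrix.ext fun a b => hF.C4_comm₃₄ hy a b h j]
  ring

end IsMinkowskiAt

/-! ### Contractions with the Cartan tensor -/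

/-- The matrix `v^s C_{sab}`. -/
def contrVec (F : LocalFn n) (x y : Coord n) (v : Fin n → ℝ) : Matrix (Fin n) (Fin n) ℝ :=
  Matrix.of fun a b => ∑ s, v s * C F s a b x y

/-- The matrix `v^s C_{sabh}`. -/
def contrVec4 (F : LocalFn n) (x y : Coord n) (h : Fin n) (v : Fin n → ℝ) :
    Matrix (Fin n) (Fin n) ℝ :=
  Matrix.of fun a b => ∑ s, v s * C4 F s a b h x y

/-- The vector `C^s_{jk}`. -/
def cVec (F : LocalFn n) (x : Coord n) (j k : Fin n) (y : Coord n) : Fin n → ℝ :=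
  fun s => CU F s j k x y

/-- The vector `C^s_{jkh}`. -/
def c4Vec (F : LocalFn n) (x y : Coord n) (j k h : Fin n) : Fin n → ℝ :=
  fun s => C4U F s j k h x y

/-- The vector `C^s_{th} C^t_{jk}`. -/
def ccVec (F : LocalFn n) (x y : Coord n) (h j k : Fin n) : Fin n → ℝ :=
  fun s => ∑ t, CU F s t h x y * CU F t j k x y

/-- The matrix `C_{sab} C^s_{jk}`. -/
def ccMat (F : LocalFn n) (x : Coord n) (j k : Fin n) (y : Coord n) :
    Matrix (Fin n) (Fin n) ℝ := contrVec F x y (cVec F x j k y)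

/-- The part of `T_{abjk}` without factors `ℓ_a`, `ℓ_b`. -/
def tMat (F : LocalFn n) (x : Coord n) (j k : Fin n) (y : Coord n) : Matrix (Fin n) (Fin n) ℝ :=
  F x y • (c4Mat F x j k y - contr F x y (cMat F x j y) (cMat F x k y)
    - contr F x y (cMat F x k y) (cMat F x j y) - ccMat F x j k y)
  + ell F k x y • cMat F x j y + ell F j x y • cMat F x k y

theorem cMat_apply (F : LocalFn n) (x y : Coord n) (j a b : Fin n) :
    cMat F x j y a b = C F a b j x y := rfl

theorem c4Mat_apply (F : LocalFn n) (x y : Coord n) (j k a b : Fin n) :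
    c4Mat F x j k y a b = C4 F a b j k x y := rfl

theorem gInvMat_apply (F : LocalFn n) (x y : Coord n) (a b : Fin n) :
    gInvMat F x y a b = gInv F a b x y := rfl

theorem contrVec_apply (F : LocalFn n) (x y : Coord n) (v : Fin n → ℝ) (a b : Fin n) :
    contrVec F x y v a b = ∑ s, v s * C F s a b x y := rfl

theorem contrVec4_apply (F : LocalFn n) (x y : Coord n) (h : Fin n) (v : Fin n → ℝ)
    (a b : Fin n) : contrVec4 F x y h v a b = ∑ s, v s * C4 F s a b h x y := rfl

theorem contr_add_left (F : LocalFn n) (x y : Coord n) (M N P : Matrix (Fin n) (Fin n) ℝ) :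
    contr F x y (M + N) P = contr F x y M P + contr F x y N P := by simp [contr, add_mul]

theorem contr_add_right (F : LocalFn n) (x y : Coord n) (M N P : Matrix (Fin n) (Fin n) ℝ) :
    contr F x y P (M + N) = contr F x y P M + contr F x y P N := by simp [contr, mul_add]

theorem contr_sub_left (F : LocalFn n) (x y : Coord n) (M N P : Matrix (Fin n) (Fin n) ℝ) :
    contr F x y (M - N) P = contr F x y M P - contr F x y N P := by simp [contr, sub_mul]

theorem contr_sub_right (F : LocalFn n) (x y : Coord n) (M N P : Matrix (Fin n) (Fin n) ℝ) :
    contr F x y P (M - N) = contr F x y P M - contr F x y P N := by simp [contr, mul_sub]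

theorem contr_smul_left (F : LocalFn n) (x y : Coord n) (c : ℝ)
    (M P : Matrix (Fin n) (Fin n) ℝ) : contr F x y (c • M) P = c • contr F x y M P := by
  simp [contr]

theorem contr_smul_right (F : LocalFn n) (x y : Coord n) (c : ℝ)
    (M P : Matrix (Fin n) (Fin n) ℝ) : contr F x y P (c • M) = c • contr F x y P M := by
  simp [contr]

namespace IsMinkowskiAt

variable {F : LocalFn n} {x y : Coord n}

theorem CU_eq_mul_gInvMat (hF : IsMinkowskiAt F x) (hy : y ≠ 0) (r q j : Fin n) :
    CU F r q j x y = (cMat F x j y * gInvMat F x y) q r := by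
  rw [hF.CU_eq hy, ← Matrix.transpose_apply (_ * _), Matrix.transpose_mul,
    hF.gInvMat_transpose hy, hF.cMat_transpose hy]

theorem CU_eq_sum (hF : IsMinkowskiAt F x) (hy : y ≠ 0) (r j k : Fin n) :
    CU F r j k x y = ∑ a, gInv F r a x y * C F a j k x y := by
  rw [hF.CU_eq hy, Matrix.mul_apply]; rfl

theorem contr_cMat_apply (hF : IsMinkowskiAt F x) (hy : y ≠ 0) (j k a b : Fin n) :
    contr F x y (cMat F x j y) (cMat F x k y) a b = ∑ s, C F s b k x y * CU F s a j x y := by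
  rw [contr, Matrix.mul_apply]
  refine Finset.sum_congr rfl fun s _ => ?_
  rw [hF.CU_eq_mul_gInvMat hy, mul_comm]; rfl

theorem sum_C_mul_CU_comm (hF : IsMinkowskiAt F x) (hy : y ≠ 0) (a b j k : Fin n) :
    ∑ s, C F s a b x y * CU F s j k x y = ∑ s, C F s j k x y * CU F s a b x y := by
  simp only [hF.CU_eq_sum hy, Finset.mul_sum]
  rw [Finset.sum_comm]
  refine Finset.sum_congr rfl fun s _ => Finset.sum_congr rfl fun t _ => ?_
  rw [hF.gInv_comm hy]; ring

theorem ccMat_apply (hF : IsMinkowskiAt F x) (hy : y ≠ 0) (a b j k : Fin n) :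
    ccMat F x j k y a b = ∑ s, C F s j k x y * CU F s a b x y := by
  rw [← hF.sum_C_mul_CU_comm hy]
  simp only [ccMat, contrVec_apply, cVec, mul_comm]

theorem ccMat_comm (hF : IsMinkowskiAt F x) (hy : y ≠ 0) (j k : Fin n) :
    ccMat F x j k y = ccMat F x k j y := by
  ext a b
  simp only [hF.ccMat_apply hy, hF.C_comm₂₃ hy _ j k]

theorem ccMat_transpose (hF : IsMinkowskiAt F x) (hy : y ≠ 0) (j k : Fin n) :
    (ccMat F x j k y).transpose = ccMat F x j k y := by
  ext a b
  simp only [Matrix.transpose_apply, hF.ccMat_apply hy, hF.CU_comm hy _ a b]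

theorem contrVec_transpose (hF : IsMinkowskiAt F x) (hy : y ≠ 0) (v : Fin n → ℝ) :
    (contrVec F x y v).transpose = contrVec F x y v := by
  ext a b
  simp only [Matrix.transpose_apply, contrVec_apply, hF.C_comm₂₃ hy _ a b]

theorem contrVec4_transpose (hF : IsMinkowskiAt F x) (hy : y ≠ 0) (h : Fin n) (v : Fin n → ℝ) :
    (contrVec4 F x y h v).transpose = contrVec4 F x y h v := by
  ext a b
  simp only [Matrix.transpose_apply, contrVec4_apply, hF.C4_comm₂₃ hy _ a b]

theorem ccVec_comm (hF : IsMinkowskiAt F x) (hy : y ≠ 0) (h j k : Fin n) :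
    ccVec F x y h j k = ccVec F x y h k j := by
  funext s
  simp only [ccVec, hF.CU_comm hy _ j k]

theorem contrVec_eq_sum (hF : IsMinkowskiAt F x) (hy : y ≠ 0) (v : Fin n → ℝ) :
    contrVec F x y v = ∑ s, v s • cMat F x s y := by
  ext a b
  simp only [Matrix.sum_apply, Matrix.smul_apply, smul_eq_mul, contrVec_apply, cMat_apply]
  exact Finset.sum_congr rfl fun s _ => by rw [hF.C_comm₁₂ hy, hF.C_comm₂₃ hy]

theorem contrVec4_eq_sum (hF : IsMinkowskiAt F x) (hy : y ≠ 0) (h : Fin n) (v : Fin n → ℝ) :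
    contrVec4 F x y h v = ∑ s, v s • c4Mat F x s h y := by
  ext a b
  simp only [Matrix.sum_apply, Matrix.smul_apply, smul_eq_mul, contrVec4_apply, c4Mat_apply]
  exact Finset.sum_congr rfl fun s _ => by rw [hF.C4_comm₁₂ hy, hF.C4_comm₂₃ hy]

theorem raise_contrVec_apply (hF : IsMinkowskiAt F x) (hy : y ≠ 0) (v : Fin n → ℝ) (i r : Fin n) :
    raise F x y (contrVec F x y v) i r = ∑ s, v s * CUU F i r s x y := by
  simp [hF.contrVec_eq_sum hy, raise, Matrix.mul_sum, Matrix.sum_mul, Matrix.sum_apply,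
    hF.CUU_eq hy]

theorem raise_contrVec4_apply (hF : IsMinkowskiAt F x) (hy : y ≠ 0) (h : Fin n) (v : Fin n → ℝ)
    (i r : Fin n) :
    raise F x y (contrVec4 F x y h v) i r = ∑ s, v s * C4UU F i r s h x y := by
  simp [hF.contrVec4_eq_sum hy, raise, Matrix.mul_sum, Matrix.sum_mul, Matrix.sum_apply,
    hF.C4UU_eq hy]

theorem sum_gInv_mul_CU (hF : IsMinkowskiAt F x) (hy : y ≠ 0) (i r q : Fin n) :
    ∑ a, gInv F r a x y * CU F i q a x y = CUU F i r q x y := by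
  rw [hF.CUU_comm hy, hF.CUU_eq hy, raise, mul_assoc, Matrix.mul_apply]
  refine Finset.sum_congr rfl fun a _ => ?_
  rw [hF.CU_comm hy, hF.CU_eq_mul_gInvMat hy]; rfl

theorem sum_gInv_mul_ccMat (hF : IsMinkowskiAt F x) (hy : y ≠ 0) (h j k r : Fin n) :
    ∑ a, gInv F r a x y * ∑ s, C F s a h x y * CU F s j k x y = ccVec F x y h j k r := by
  simp only [ccVec, hF.CU_eq_sum hy r, Finset.mul_sum, Finset.sum_mul]
  rw [Finset.sum_comm]
  refine Finset.sum_congr rfl fun s _ => Finset.sum_congr rfl fun a _ => ?_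
  rw [hF.C_comm₁₂ hy]; simp only [mul_assoc]

/-! ### The T-tensor -/

/-- For fixed j and k the part carrying ℓ_a or ℓ_b is a sum of two outer products. Treating it apart
lets the rest be raised, contracted and differentiated as a matrix. -/
theorem T_eq (hF : IsMinkowskiAt F x) (hy : y ≠ 0) (a b j k : Fin n) :
    T F a b j k x y = tMat F x j k y a b + C F a j k x y * ell F b x y
      + C F b j k x y * ell F a x y := by
  simp only [T, tMat, Matrix.add_apply, Matrix.sub_apply, Matrix.smul_apply, smul_eq_mul,
    hF.contr_cMat_apply hy, hF.ccMat_apply hy, Finset.sum_add_distrib, cMat_apply, c4Mat_apply]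
  rw [← hF.sum_C_mul_CU_comm hy b k j a, hF.sum_C_mul_CU_comm hy b a j k]
  simp only [fun s => hF.CU_comm hy s b a, fun s => hF.CU_comm hy s j a]
  ring

theorem TU_eq (hF : IsMinkowskiAt F x) (hy : y ≠ 0) (r q j k : Fin n) :
    TU F r q j k x y = (gInvMat F x y * tMat F x j k y) r q + CU F r j k x y * ell F q x y
      + C F q j k x y * ellU F r x y := by
  simp only [TU, hF.T_eq hy, Matrix.mul_apply, hF.CU_eq_sum hy, ellU, Finset.mul_sum,
    Finset.sum_mul, ← Finset.sum_add_distrib]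
  refine Finset.sum_congr rfl fun a _ => ?_
  change _ = gInv F r a x y * _ + _ + _
  ring

theorem TUU_eq (hF : IsMinkowskiAt F x) (hy : y ≠ 0) (r i j k : Fin n) :
    TUU F r i j k x y = raise F x y (tMat F x j k y) r i + CU F r j k x y * ellU F i x y
      + CU F i j k x y * ellU F r x y := by
  rw [hF.raise_apply hy]
  simp only [TUU, hF.T_eq hy, hF.CU_eq_sum hy, ellU, Finset.sum_mul_sum]
  rw [Finset.sum_comm (f := fun a b => gInv F i a x y * C F a j k x y * (gInv F r b x y * _))]
  simp only [← Finset.sum_add_distrib]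
  refine Finset.sum_congr rfl fun a _ => Finset.sum_congr rfl fun b _ => ?_
  ring

/-- A second form of T^r_{jkh}, as a vector in r, suited to terms where only the raised index is
contracted. -/
theorem TU_eq_vec (hF : IsMinkowskiAt F x) (hy : y ≠ 0) (r j k h : Fin n) :
    TU F r j k h x y = F x y * (c4Vec F x y j k h r - ccVec F x y h j k r - ccVec F x y k j h r
        - ccVec F x y j k h r) + CU F r j k x y * ell F h x y + CU F r j h x y * ell F k x y
      + CU F r k h x y * ell F j x y + C F j k h x y * ellU F r x y := by
  have hT : ∀ a, T F a j k h x y = F x y * (C4 F a j k h x y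
      - ∑ s, C F s a h x y * CU F s j k x y - ∑ s, C F s a k x y * CU F s j h x y
      - ∑ s, C F s a j x y * CU F s k h x y) + C F a j k x y * ell F h x y
      + C F a j h x y * ell F k x y + C F a k h x y * ell F j x y
      + C F j k h x y * ell F a x y := by
    intro a
    simp only [T, Finset.sum_add_distrib]
    rw [hF.sum_C_mul_CU_comm hy j k a h]
    simp only [fun s => hF.C_comm₂₃ hy s k a, fun s => hF.C_comm₂₃ hy s j a]
    ring
  -- Naming the inner sums keeps them atomic while the outer sums are merged.
  obtain ⟨B, hB⟩ : ∃ B : Fin n → Fin n → Fin n → Fin n → ℝ,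
      ∀ a h j k, ∑ s, C F s a h x y * CU F s j k x y = B a h j k := ⟨_, fun _ _ _ _ => rfl⟩
  simp only [TU, hT, c4Vec, C4U, ← hF.sum_gInv_mul_ccMat hy, hF.CU_eq_sum hy r, ellU, hB]
  simp only [Finset.mul_sum, Finset.sum_mul, ← Finset.sum_add_distrib, ← Finset.sum_sub_distrib]
  exact Finset.sum_congr rfl fun a _ => by ring

theorem sum_ell_mul_CU (hF : IsMinkowskiAt F x) (hy : y ≠ 0) (j k : Fin n) :
    ∑ q, ell F q x y * CU F q j k x y = 0 := by
  rw [← hF.sum_C_mul_ellU hy j k]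
  simp only [hF.CU_eq_sum hy, ellU, Finset.mul_sum]
  rw [Finset.sum_comm]
  refine Finset.sum_congr rfl fun a _ => Finset.sum_congr rfl fun b _ => ?_
  rw [hF.gInv_comm hy, hF.C_comm₁₂ hy]; ring

theorem sum_CU_mul_ellU (hF : IsMinkowskiAt F x) (hy : y ≠ 0) (r k : Fin n) :
    ∑ a, CU F r k a x y * ellU F a x y = 0 := by
  simp only [hF.CU_eq_sum hy, Finset.sum_mul]
  rw [Finset.sum_comm]
  refine Finset.sum_eq_zero fun b _ => ?_
  simp only [hF.C_comm₂₃ hy b k, mul_assoc, ← Finset.mul_sum, hF.sum_C_mul_ellU hy, mul_zero]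

/-- The index q is lowered on C and raised on v, so that a vanishing contraction with ℓ can be
recognised. -/
theorem sum_mul_CUU (hF : IsMinkowskiAt F x) (hy : y ≠ 0) (v : Fin n → ℝ) (r k : Fin n) :
    ∑ q, v q * CUU F q r k x y = ∑ a, CU F r k a x y * ∑ q, gInv F a q x y * v q := by
  simp only [hF.CUU_comm hy _ r, ← hF.sum_gInv_mul_CU hy, Finset.mul_sum]
  rw [Finset.sum_comm]
  refine Finset.sum_congr rfl fun a _ => Finset.sum_congr rfl fun b _ => ?_
  rw [hF.gInv_comm hy]; ring

theorem sum_ell_mul_CUU (hF : IsMinkowskiAt F x) (hy : y ≠ 0) (r k : Fin n) :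
    ∑ q, ell F q x y * CUU F q r k x y = 0 := by
  rw [hF.sum_mul_CUU hy]
  exact hF.sum_CU_mul_ellU hy r k

/-- Of the two outer products in T, the one with ℓ_q dies against C; the one with ℓ^i survives and
leaves a product of two Cartan tensors. -/
theorem sum_TU_mul_CUU (hF : IsMinkowskiAt F x) (hy : y ≠ 0) (i r j k h : Fin n) :
    ∑ q, TU F i q j h x y * CUU F q r k x y
      = raise F x y (contr F x y (tMat F x j h y) (cMat F x k y)) i r
        + ellU F i x y * ccVec F x y k j h r := by
  have h₁ : ∑ q, C F q j h x y * CUU F q r k x y = ccVec F x y k j h r := by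
    simp only [hF.sum_mul_CUU hy, ← hF.CU_eq_sum hy, hF.CU_comm hy r k, ccVec]
  simp only [hF.TU_eq hy, add_mul, Finset.sum_add_distrib, hF.CUU_eq hy, sum_gInvMat_mul_raise]
  simp only [← hF.CUU_eq hy, mul_assoc, ← Finset.mul_sum, hF.sum_ell_mul_CUU hy]
  simp only [mul_left_comm _ (ellU F i x y), ← Finset.mul_sum, h₁]
  ring

theorem sum_TUU_mul_CU (hF : IsMinkowskiAt F x) (hy : y ≠ 0) (i r j k h : Fin n) :
    ∑ q, TUU F r i q h x y * CU F q j k x y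
      = F x y * (raise F x y (contrVec4 F x y h (cVec F x j k y)) r i
        - raise F x y (contr F x y (cMat F x h y) (ccMat F x j k y)) r i
        - raise F x y (contr F x y (ccMat F x j k y) (cMat F x h y)) r i
        - raise F x y (contrVec F x y (ccVec F x y h j k)) r i)
        + raise F x y (ccMat F x j k y) r i * ell F h x y
        + ccVec F x y h j k r * ellU F i x y + ccVec F x y h j k i * ellU F r x y := by
  have h₁ : raise F x y (contr F x y (cMat F x h y) (ccMat F x j k y)) r i
      = ∑ q, CU F q j k x y * raise F x y (contr F x y (cMat F x h y) (cMat F x q y)) r i := by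
    simp [ccMat, hF.contrVec_eq_sum hy, raise, contr, Matrix.mul_sum, Matrix.sum_mul,
      Matrix.sum_apply, cVec]
  have h₂ : raise F x y (contr F x y (ccMat F x j k y) (cMat F x h y)) r i
      = ∑ q, CU F q j k x y * raise F x y (contr F x y (cMat F x q y) (cMat F x h y)) r i := by
    simp [ccMat, hF.contrVec_eq_sum hy, raise, contr, Matrix.mul_sum, Matrix.sum_mul,
      Matrix.sum_apply, cVec]
  have h₃ : raise F x y (contrVec F x y (ccVec F x y h j k)) r i
      = ∑ q, CU F q j k x y * raise F x y (ccMat F x q h y) r i := by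
    simp only [ccMat, hF.raise_contrVec_apply hy, ccVec, cVec, Finset.sum_mul, Finset.mul_sum]
    rw [Finset.sum_comm]
    exact Finset.sum_congr rfl fun a _ => Finset.sum_congr rfl fun b _ => by ring
  -- The ℓ_q C_h term of `tMat` at (q, h) contracts to zero; it is put back so that both sides agree
  -- term by term in q.
  have h₄ : 0 = (∑ q, ell F q x y * CU F q j k x y) * raise F x y (cMat F x h y) r i := by
    rw [hF.sum_ell_mul_CU hy, zero_mul]
  rw [← add_zero (ccVec F x y h j k i * _), h₄, h₁, h₂, h₃, hF.raise_contrVec4_apply hy, ccMat,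
    hF.raise_contrVec_apply hy]
  simp only [ccVec, cVec, Finset.mul_sum, Finset.sum_mul, ← Finset.sum_add_distrib,
    ← Finset.sum_sub_distrib]
  refine Finset.sum_congr rfl fun q _ => ?_
  simp only [hF.TUU_eq hy, tMat, raise_add, raise_sub, raise_smul, Matrix.add_apply,
    Matrix.sub_apply, Matrix.smul_apply, smul_eq_mul, hF.C4UU_eq hy, hF.CUU_eq hy]
  ring

theorem sum_TU_mul_CUU_right (hF : IsMinkowskiAt F x) (hy : y ≠ 0) (i r j k h : Fin n) :
    ∑ q, TU F q j k h x y * CUU F r i q x y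
      = F x y * (raise F x y (contrVec F x y (c4Vec F x y j k h)) r i
        - raise F x y (contrVec F x y (ccVec F x y h j k)) r i
        - raise F x y (contrVec F x y (ccVec F x y k j h)) r i
        - raise F x y (contrVec F x y (ccVec F x y j k h)) r i)
        + raise F x y (ccMat F x j k y) r i * ell F h x y
        + raise F x y (ccMat F x j h y) r i * ell F k x y
        + raise F x y (ccMat F x k h y) r i * ell F j x y := by
  -- This is the contribution of the ℓ^q term of T^q_{jkh}, reinserted to compare the sums termwise.
  have h₁ : 0 = C F j k h x y * ∑ q, CUU F r i q x y * ellU F q x y := by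
    simp only [← hF.sum_gInv_mul_CU hy, Finset.sum_mul]
    rw [Finset.sum_comm]
    simp only [mul_assoc, hF.CU_comm hy r, ← Finset.mul_sum, hF.sum_CU_mul_ellU hy, mul_zero,
      Finset.sum_const_zero]
  rw [← add_zero (raise F x y (ccMat F x k h y) r i * _), h₁]
  simp only [ccMat, hF.raise_contrVec_apply hy, Finset.mul_sum, Finset.sum_mul,
    ← Finset.sum_add_distrib, ← Finset.sum_sub_distrib]
  refine Finset.sum_congr rfl fun q _ => ?_
  rw [hF.TU_eq_vec hy]
  simp only [cVec]
  ring

/-! ### The v-curvature -/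

theorem SUU_eq (hF : IsMinkowskiAt F x) (hy : y ≠ 0) (t i r k : Fin n) :
    SUU F t i r k x y = ∑ q, (CU F q t k x y * CUU F i r q x y
      - CUU F q r t x y * CU F i q k x y) := by
  simp only [SUU, S, Finset.mul_sum]
  rw [Finset.sum_comm]
  simp only [← hF.sum_gInv_mul_CU hy _ r, Finset.mul_sum, Finset.sum_mul,
    ← Finset.sum_sub_distrib]
  exact Finset.sum_congr rfl fun q _ => Finset.sum_congr rfl fun a _ => by ring

theorem sum_g_mul_CU (hF : IsMinkowskiAt F x) (hy : y ≠ 0) (j q k : Fin n) :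
    ∑ b, g F j b x y * CU F b q k x y = C F j q k x y := by
  have : cMat F x k y = gMatrix F x y * (gInvMat F x y * cMat F x k y) := by
    rw [← mul_assoc, hF.mul_gInvMat hy, one_mul]
  rw [← cMat_apply, this, Matrix.mul_apply]
  simp only [← hF.CU_eq hy]; rfl

/-- Lowering an index by g undoes the inverse metric inside C^h_{qk}, and the raised index is
absorbed into the other factor. -/
theorem SL_eq (hF : IsMinkowskiAt F x) (hy : y ≠ 0) (t j k r : Fin n) :
    SL F t j k r x y = ∑ q, (CUU F q r t x y * C F j q k x y
      - CU F q t k x y * CU F r j q x y) := by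
  have hS : ∀ a, ∑ b, g F j b x y * gInv F r a x y * S F t b k a x y
      = ∑ q, gInv F r a x y * (CU F q t a x y * C F j q k x y - CU F q t k x y * C F a j q x y) := by
    intro a
    simp only [S, Finset.mul_sum]
    rw [Finset.sum_comm]
    refine Finset.sum_congr rfl fun q _ => ?_
    rw [hF.C_comm₁₂ hy a j, hF.C_comm₂₃ hy j a, ← hF.sum_g_mul_CU hy j q k,
      ← hF.sum_g_mul_CU hy j q a]
    simp only [Finset.mul_sum, ← Finset.sum_sub_distrib]
    exact Finset.sum_congr rfl fun b _ => by ring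
  simp only [SL, hS]
  rw [Finset.sum_comm]
  simp only [← hF.sum_gInv_mul_CU hy _ r, hF.CU_eq_sum hy r, Finset.mul_sum, Finset.sum_mul,
    ← Finset.sum_sub_distrib]
  exact Finset.sum_congr rfl fun q _ => Finset.sum_congr rfl fun a _ => by ring

theorem sum_CU_mul_SUU (hF : IsMinkowskiAt F x) (hy : y ≠ 0) (i r j k h : Fin n) :
    ∑ t, CU F t h j x y * SUU F t i r k x y
      = raise F x y (contrVec F x y (ccVec F x y k h j)) i r
        - raise F x y (contr F x y (cMat F x k y) (ccMat F x h j y)) i r := by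
  simp only [← sum_gInvMat_mul_raise, hF.raise_contrVec_apply hy, ccMat, ← hF.CU_eq hy,
    hF.SUU_eq hy, ccVec, cVec, Finset.mul_sum, Finset.sum_mul, ← Finset.sum_sub_distrib]
  rw [Finset.sum_comm]
  exact Finset.sum_congr rfl fun q _ => Finset.sum_congr rfl fun a _ => by ring

theorem sum_CUU_mul_SL (hF : IsMinkowskiAt F x) (hy : y ≠ 0) (i r j k h : Fin n) :
    ∑ t, CUU F t i h x y * SL F t j k r x y
      = raise F x y (contr F x y (cMat F x h y) (ccMat F x j k y)) i r
        - raise F x y (contr F x y (cMat F x h y)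
            (contr F x y (cMat F x k y) (cMat F x j y))) i r := by
  have h₁ : ∀ t, ∑ q, CUU F q r t x y * C F j q k x y
      = (ccMat F x j k y * gInvMat F x y) t r := by
    intro t
    rw [Matrix.mul_apply]
    simp only [hF.ccMat_apply hy, ← hF.sum_gInv_mul_CU hy, Finset.sum_mul]
    rw [Finset.sum_comm]
    refine Finset.sum_congr rfl fun a _ => Finset.sum_congr rfl fun q _ => ?_
    rw [hF.C_comm₁₂ hy j, hF.gInv_comm hy, gInvMat_apply]; ring
  have h₂ : ∀ t, ∑ q, CU F q t k x y * CU F r j q x y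
      = (cMat F x k y * gInvMat F x y * (cMat F x j y * gInvMat F x y)) t r := by
    intro t
    rw [Matrix.mul_apply]
    simp only [← hF.CU_eq_mul_gInvMat hy, hF.CU_comm hy r j]
  simp only [hF.SL_eq hy, Finset.sum_sub_distrib, h₁, h₂, mul_sub, hF.CUU_comm hy _ i]
  simp only [hF.CUU_eq hy, ← Matrix.mul_apply]
  simp [raise, contr, mul_assoc]

/-! ### The angular metric -/

theorem angUU_eq (hF : IsMinkowskiAt F x) (hy : y ≠ 0) (i r : Fin n) :
    angUU F i r x y = gInv F i r x y - ellU F i x y * ellU F r x y := by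
  have h₁ : gInv F i r x y = ∑ a, ∑ b, gInv F i a x y * gInv F r b x y * g F a b x y := by
    have : raise F x y (gMatrix F x y) = gInvMat F x y := by
      rw [raise, hF.gInvMat_mul hy, one_mul]
    rw [← gInvMat_apply, ← this, hF.raise_apply hy]; rfl
  rw [h₁]
  simp only [angUU, ang, ellU, Finset.sum_mul_sum, ← Finset.sum_sub_distrib]
  exact Finset.sum_congr rfl fun q _ => Finset.sum_congr rfl fun a _ => by ring

/-! ### The derivative of the T-tensor -/

theorem hasPartialD_CU (hF : IsMinkowskiAt F x) (hy : y ≠ 0) (r j k h : Fin n) :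
    HasPartialD h (CU F r j k x) (c4Vec F x y j k h r - 2 * ccVec F x y h j k r) y := by
  refine (((hF.hasMatrixPartialD_gInvMat hy h).mul (hF.hasMatrixPartialD_cMat hy k h) r j
    ).congr_of_ne_zero hy fun z hz => hF.CU_eq hz r j k).congr_deriv ?_
  simp only [ccVec, hF.CU_eq hy, ← Matrix.mul_apply, c4Vec, C4U_eq]
  simp [mul_assoc]
  ring

/-- The derivative of g^{ia} contributes −2 C^{ia}_h ℓ_a = 0, so only the derivative of ℓ_a remains.
-/
theorem hasPartialD_ellU (hF : IsMinkowskiAt F x) (hy : y ≠ 0) (i h : Fin n) :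
    HasPartialD h (ellU F i x) (angU F i h x y / F x y) y := by
  have h₁ : HasPartialD h (ellU F i x) _ y := HasPartialD.sum fun a _ =>
    (hF.hasMatrixPartialD_gInvMat_raise hy h i a).mul (hF.hasPartialD_ell hy a h)
  refine h₁.congr_deriv ?_
  have h₂ : ∀ a, ang F h a x y = ang F a h x y := fun a => by
    rw [ang, ang, hF.g_comm hy, mul_comm (ell F h x y)]
  have h₃ := hF.sum_ell_mul_CUU hy i h
  simp only [hF.CUU_comm hy _ i, hF.CUU_eq hy] at h₃
  simp only [Matrix.smul_apply, smul_eq_mul, Finset.sum_add_distrib, mul_assoc, ← Finset.mul_sum,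
    mul_comm (raise _ _ _ _ _ _), h₃, h₂, angU, Finset.sum_div, mul_div_assoc, gInvMat_apply]
  simp

theorem hasMatrixPartialD_ccMat (hF : IsMinkowskiAt F x) (hy : y ≠ 0) (j k h : Fin n) :
    HasMatrixPartialD h (ccMat F x j k)
      (contrVec4 F x y h (cVec F x j k y) + contrVec F x y (c4Vec F x y j k h)
        - (2 : ℝ) • contrVec F x y (ccVec F x y h j k)) y := by
  intro a b
  have h₁ : HasPartialD h (fun z => ∑ s, CU F s j k x z * C F s a b x z) _ y := HasPartialD.sum fun s _ =>
    (hF.hasPartialD_CU hy s j k h).mul (hF.hasPartialD_C hy s a b h)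
  refine h₁.congr_deriv ?_
  simp only [Matrix.sub_apply, Matrix.add_apply, Matrix.smul_apply, contrVec_apply,
    contrVec4_apply, smul_eq_mul, Finset.mul_sum, ← Finset.sum_sub_distrib,
    ← Finset.sum_add_distrib, cVec]
  exact Finset.sum_congr rfl fun s _ => by ring

theorem hasMatrixPartialD_tMat (hF : IsMinkowskiAt F x) (hy : y ≠ 0) (j k h : Fin n) :
    HasMatrixPartialD h (tMat F x j k)
      (ell F h x y • (c4Mat F x j k y - contr F x y (cMat F x j y) (cMat F x k y)
          - contr F x y (cMat F x k y) (cMat F x j y) - ccMat F x j k y)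
        + F x y • (c5Mat F x j k h y
          - (contr F x y (c4Mat F x j h y) (cMat F x k y)
            + contr F x y (cMat F x j y) (c4Mat F x k h y)
            - (2 : ℝ) • contr F x y (cMat F x j y) (contr F x y (cMat F x h y) (cMat F x k y)))
          - (contr F x y (c4Mat F x k h y) (cMat F x j y)
            + contr F x y (cMat F x k y) (c4Mat F x j h y)
            - (2 : ℝ) • contr F x y (cMat F x k y) (contr F x y (cMat F x h y) (cMat F x j y)))
          - (contrVec4 F x y h (cVec F x j k y) + contrVec F x y (c4Vec F x y j k h)
            - (2 : ℝ) • contrVec F x y (ccVec F x y h j k)))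
        + ((ang F h k x y / F x y) • cMat F x j y + ell F k x y • c4Mat F x j h y)
        + ((ang F h j x y / F x y) • cMat F x k y + ell F j x y • c4Mat F x k h y)) y := by
  have hC := fun j => hF.hasMatrixPartialD_cMat hy j h
  have h₁ := hF.hasMatrixPartialD_c4Mat hy j k h
  have h₂ := fun j k => hF.hasMatrixPartialD_contr hy (hC j) (hC k)
  have h₃ := hF.hasMatrixPartialD_ccMat hy j k h
  intro a b
  refine ((((hF.hasPartialD_F hy h).mul ((((h₁ a b).sub (h₂ j k a b)).sub (h₂ k j a b)).sub
    (h₃ a b))).add ((hF.hasPartialD_ell hy k h).mul (hC j a b))).add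
    ((hF.hasPartialD_ell hy j h).mul (hC k a b))).congr_deriv ?_
  simp only [Matrix.sub_apply, Matrix.add_apply, Matrix.smul_apply, smul_eq_mul]

/-- In F ∂̇_h T^{ri}_{jk} the factor F clears the denominators of ∂̇ℓ. The resulting C^r_{jk} h^i_h
and C^i_{jk} h^r_h cancel the explicit ones, while its h_{kh} and h_{jh} terms double the explicit
ones. All ℓℓ terms hidden in the angular metric cancel against those of T, which leaves the metric
terms of the first form. -/
theorem conformalB_coeff_eq (hF : IsMinkowskiAt F x) (hy : y ≠ 0) (i r j k h : Fin n) :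
    F x y ^ 2 * C5UU F i r j k h x y
    + 2 * (CUU F i r j x y * g F k h x y + CUU F i r h x y * g F j k x y
        + CUU F i r k x y * g F j h x y)
    - 2 * gInv F i r x y * C F j k h x y
    + 2 * F x y * (C4UU F i r j k x y * ell F h x y + C4UU F i r h j x y * ell F k x y
        + C4UU F i r k h x y * ell F j x y)
    - 4 * F x y * (∑ q,
        ((CU F r q j x y * CUU F q i k x y + CU F i q j x y * CUU F q r k x y) * ell F h x y
        + (CU F r q j x y * CUU F q i h x y + CU F i q j x y * CUU F q r h x y) * ell F k x y
        + (CU F r q k x y * CUU F q i h x y + CU F i q k x y * CUU F q r h x y) * ell F j x y))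
    - 2 * F x y ^ 2 * (∑ q,
        ((C4U F r q j k x y * CUU F q i h x y + C4U F i q j k x y * CUU F q r h x y)
        + (C4U F r q j h x y * CUU F q i k x y + C4U F i q j h x y * CUU F q r k x y)
        + (C4U F r q k h x y * CUU F q i j x y + C4U F i q k h x y * CUU F q r j x y)))
    + 4 * F x y ^ 2 * (∑ q, ∑ t,
        ((C F q t j x y * CUU F t i k x y + C F q t k x y * CUU F t i j x y) * CUU F q r h x y
        + (C F q t j x y * CUU F i t h x y + C F q t h x y * CUU F i t j x y) * CUU F q r k x y
        + (C F q t k x y * CUU F i t h x y + C F q t h x y * CUU F i t k x y)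
            * CUU F q r j x y)) =
    F x y * dotD h (TUU F r i j k) x y
    + (TUU F r i j h x y * ell F k x y + TUU F r i k h x y * ell F j x y
        + TUU F r i j k x y * ell F h x y - TU F r j k h x y * ellU F i x y
        - TU F i j k h x y * ellU F r x y)
    - F x y * (∑ q,
        (TU F i q j h x y * CUU F q r k x y + TU F r q k h x y * CUU F q i j x y
        + TU F r q j h x y * CUU F q i k x y + TU F i q k h x y * CUU F q r j x y
        - TUU F r i q h x y * CU F q j k x y - TU F q j k h x y * CUU F r i q x y))
    + (CUU F r i j x y * ang F k h x y + CUU F r i k x y * ang F j h x y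
        + 2 * CUU F i r h x y * ang F j k x y - CU F r j k x y * angU F i h x y
        - CU F i j k x y * angU F r h x y - 2 * C F j k h x y * angUU F i r x y)
    + F x y ^ 2 * (∑ t,
        (CU F t h j x y * SUU F t i r k x y + CU F t h k x y * SUU F t r i j x y
        - CUU F t i h x y * SL F t j k r x y - CUU F t r h x y * SL F t k j i x y
        - CUU F t i j x y * SL F t h k r x y - CUU F t r k x y * SL F t h j i x y)) := by
  have hF0 := (hF.pos y hy).ne'
  have h₁ := hF.hasMatrixPartialD_raise hy (hF.hasMatrixPartialD_tMat hy j k h) r i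
  have h₂ := fun r i => (hF.hasPartialD_CU hy r j k h).mul (hF.hasPartialD_ellU hy i h)
  rw [dotD, (((h₁.add (h₂ r i)).add (h₂ i r)).congr_of_ne_zero hy
    fun z hz => hF.TUU_eq hz r i j k).2]
  simp only [add_mul, Finset.sum_add_distrib, Finset.sum_sub_distrib, ← Finset.sum_mul,
    hF.sum_CU_mul_CUU hy, hF.sum_C4U_mul_CUU hy, hF.sum_sum_C_mul_CUU hy,
    hF.sum_sum_C_mul_CUU' hy, hF.sum_TU_mul_CUU hy, hF.sum_TU_mul_CUU_right hy,
    hF.sum_TUU_mul_CU hy, hF.sum_CU_mul_SUU hy, hF.sum_CUU_mul_SL hy]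
  have h₃ : (c5Mat F x j k h y).transpose = c5Mat F x j k h y := by
    ext a b
    exact (hF.hasPartialD_C4 hy b a j k h).unique
      ((hF.hasPartialD_C4 hy a b j k h).congr_of_ne_zero hy fun z hz => hF.C4_comm₁₂ hz b a j k)
  simp only [hF.TUU_eq hy, hF.TU_eq_vec hy, hF.angUU_eq hy, ang, tMat,
    hF.CUU_eq hy, hF.C4UU_eq hy, hF.C5UU_eq hy, hF.raise_comm hy _ i r,
    hF.contr_transpose hy, hF.cMat_transpose hy, hF.c4Mat_transpose hy, contr_assoc,
    hF.ccMat_transpose hy, hF.contrVec_transpose hy, hF.contrVec4_transpose hy,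
    Matrix.transpose_add, Matrix.transpose_sub, Matrix.transpose_smul,
    raise_sub, raise_add, raise_smul, Matrix.smul_apply, Matrix.sub_apply, Matrix.add_apply,
    contr_add_left, contr_add_right, contr_sub_left, contr_sub_right, contr_smul_left,
    contr_smul_right, smul_eq_mul, h₃]
  -- The index symmetries not yet normalised; afterwards equal tensors are equal atoms for `ring`.
  rw [show c4Mat F x h j y = c4Mat F x j h y from Matrix.ext fun a b => hF.C4_comm₃₄ hy a b h j,
    hF.g_comm hy h k, hF.g_comm hy h j, hF.ccMat_comm hy h j, hF.ccMat_comm hy h k,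
    hF.ccMat_comm hy k j, hF.ccVec_comm hy k h j, hF.ccVec_comm hy j h k]
  field_simp
  ring

end IsMinkowskiAt

/-! ### Joint smoothness -/

/-- The partial derivative is the joint derivative in the constant direction (e_i, 0), hence jointly
smooth. -/
theorem contDiffOn_baseD {f : LocalFn n} {V : Set (Coord n × Coord n)} (hV : IsOpen V)
    (hf : ContDiffOn ℝ ∞ (fun p : Coord n × Coord n => f p.1 p.2) V) (i : Fin n) :
    ContDiffOn ℝ ∞ (fun p : Coord n × Coord n => baseD i f p.1 p.2) V := by
  refine ((hf.fderiv_of_isOpen (m := ∞) hV le_rfl).clm_apply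
    (contDiffOn_const (c := (EuclideanSpace.single i (1 : ℝ), (0 : Coord n))))).congr fun p hp => ?_
  have hd := ((hf.contDiffAt (hV.mem_nhds hp)).differentiableAt (by simp)).hasFDerivAt
  have : HasFDerivAt (fun x' => f x' p.2) _ p.1 :=
    HasFDerivAt.comp (g := fun p : Coord n × Coord n => f p.1 p.2)
      (f := fun x' => (x', p.2)) p.1 hd
      (hasFDerivAt_prodMk_left p.1 p.2)
  rw [baseD, partialD, this.fderiv]
  simp

theorem contDiffOn_dotD {f : LocalFn n} {V : Set (Coord n × Coord n)} (hV : IsOpen V)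
    (hf : ContDiffOn ℝ ∞ (fun p : Coord n × Coord n => f p.1 p.2) V) (i : Fin n) :
    ContDiffOn ℝ ∞ (fun p : Coord n × Coord n => dotD i f p.1 p.2) V := by
  refine ((hf.fderiv_of_isOpen (m := ∞) hV le_rfl).clm_apply
    (contDiffOn_const (c := ((0 : Coord n), EuclideanSpace.single i (1 : ℝ))))).congr fun p hp => ?_
  have hd := ((hf.contDiffAt (hV.mem_nhds hp)).differentiableAt (by simp)).hasFDerivAt
  have : HasFDerivAt (f p.1) _ p.2 :=
    HasFDerivAt.comp (g := fun p : Coord n × Coord n => f p.1 p.2)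
      (f := fun y' => (p.1, y')) p.2 hd
      (hasFDerivAt_prodMk_right p.1 p.2)
  rw [dotD, partialD, this.fderiv]
  simp

/-- `F` is the coordinate expression of a Finsler structure over the open set `U`. -/
structure IsFinslerOn (F : LocalFn n) (U : Set (Coord n)) : Prop where
  isOpen : IsOpen U
  smooth : ContDiffOn ℝ ∞ (fun p : Coord n × Coord n => F p.1 p.2) (U ×ˢ {0}ᶜ)
  minkowski : ∀ x ∈ U, IsMinkowskiAt F x

namespace IsFinslerOn

variable {F : LocalFn n} {U : Set (Coord n)} {x y : Coord n}

theorem isOpen_prod (hF : IsFinslerOn F U) : IsOpen (U ×ˢ ({0}ᶜ : Set (Coord n))) :=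
  hF.isOpen.prod isOpen_compl_singleton

theorem contDiffOn_sq (hF : IsFinslerOn F U) :
    ContDiffOn ℝ ∞ (fun p : Coord n × Coord n => sq F p.1 p.2) (U ×ˢ {0}ᶜ) := hF.smooth.pow 2

theorem hasPartialD_base {f : LocalFn n} (hF : IsFinslerOn F U)
    (hf : ContDiffOn ℝ ∞ (fun p : Coord n × Coord n => f p.1 p.2) (U ×ˢ {0}ᶜ))
    (hx : x ∈ U) (hy : y ≠ 0) (r : Fin n) :
    HasPartialD r (fun x' => f x' y) (baseD r f x y) x := by
  have hd : DifferentiableAt ℝ (fun p : Coord n × Coord n => f p.1 p.2) (x, y) :=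
    (hf.contDiffAt (hF.isOpen_prod.mem_nhds (Set.mk_mem_prod hx hy))).differentiableAt (by simp)
  exact ⟨DifferentiableAt.comp (g := fun p : Coord n × Coord n => f p.1 p.2)
    (f := fun x' => (x', y)) x hd (hasFDerivAt_prodMk_left x y).differentiableAt, rfl⟩

theorem contDiffOn_fiber {f : LocalFn n}
    (hf : ContDiffOn ℝ ∞ (fun p : Coord n × Coord n => f p.1 p.2) (U ×ˢ {0}ᶜ)) (hx : x ∈ U) :
    ContDiffOn ℝ ∞ (f x) {0}ᶜ :=
  hf.comp (g := fun p : Coord n × Coord n => f p.1 p.2) (f := fun z => (x, z))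
    (contDiff_prodMk_right x).contDiffOn fun _ hz => ⟨hx, hz⟩

theorem contDiffOn_spray (hF : IsFinslerOn F U) (hx : x ∈ U) (i : Fin n) :
    ContDiffOn ℝ ∞ (spray F i x) {0}ᶜ := by
  have hV := hF.isOpen_prod
  refine contDiffOn_const.mul (ContDiffOn.sum fun h _ =>
    ((hF.minkowski x hx).contDiffOn_gInv i h).mul ((ContDiffOn.sum fun r _ => ?_).sub ?_))
  · exact (EuclideanSpace.proj r : Coord n →L[ℝ] ℝ).contDiff.contDiffOn.mul
      (contDiffOn_fiber (contDiffOn_baseD hV (contDiffOn_dotD hV hF.contDiffOn_sq h) r) hx)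
  · exact contDiffOn_fiber (contDiffOn_baseD hV hF.contDiffOn_sq h) hx

end IsFinslerOn

/-! ### Conformal change -/

/-- The conformal change `e^{s(x)} F(x, y)` in coordinates. -/
def localConformal (s : Coord n → ℝ) (F : LocalFn n) : LocalFn n :=
  fun x y => Real.exp (s x) * F x y

theorem sq_localConformal (s : Coord n → ℝ) (F : LocalFn n) :
    sq (localConformal s F) = fun x y => Real.exp (2 * s x) * sq F x y := by
  funext x y
  rw [sq, localConformal, mul_pow, ← Real.exp_nat_mul]; rfl

theorem dotD_sq_localConformal (s : Coord n → ℝ) (F : LocalFn n) (h : Fin n) :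
    dotD h (sq (localConformal s F)) = fun x y => Real.exp (2 * s x) * dotD h (sq F) x y := by
  funext x y
  rw [sq_localConformal, dotD, partialD_const_mul]; rfl

theorem gMatrix_localConformal (s : Coord n → ℝ) (F : LocalFn n) (x y : Coord n) :
    gMatrix (localConformal s F) x y = Real.exp (2 * s x) • gMatrix F x y := by
  ext i j
  simp only [gMatrix, Matrix.of_apply, g, dotD_sq_localConformal, Matrix.smul_apply, smul_eq_mul]
  rw [dotD, partialD_const_mul, dotD]; ring

namespace IsFinslerOn

variable {F : LocalFn n} {U : Set (Coord n)} {s : Coord n → ℝ} {x y : Coord n}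

theorem gInv_localConformal (hF : IsFinslerOn F U) (hx : x ∈ U) (hy : y ≠ 0) (i j : Fin n) :
    gInv (localConformal s F) i j x y = (Real.exp (2 * s x))⁻¹ * gInv F i j x y := by
  have h₁ : (gMatrix (localConformal s F) x y)⁻¹ = (Real.exp (2 * s x))⁻¹ • (gMatrix F x y)⁻¹ := by
    refine Matrix.inv_eq_left_inv ?_
    have := (hF.minkowski x hx).gInvMat_mul hy
    rw [gInvMat] at this
    rw [gMatrix_localConformal, Matrix.smul_mul, Matrix.mul_smul, this, smul_smul,
      inv_mul_cancel₀ (Real.exp_ne_zero _), one_smul]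
  rw [gInv, h₁]; rfl

theorem hasPartialD_exp (hF : IsFinslerOn F U) (hs : ContDiffOn ℝ ∞ s U) (hx : x ∈ U)
    (r : Fin n) :
    HasPartialD r (fun z => Real.exp (2 * s z)) (Real.exp (2 * s x) * (2 * partialD r s x)) x := by
  have hd : DifferentiableAt ℝ s x :=
    (hs.contDiffAt (hF.isOpen.mem_nhds hx)).differentiableAt (by simp)
  have := (hd.hasFDerivAt.const_mul 2).exp
  refine ⟨this.differentiableAt, ?_⟩
  rw [partialD, this.fderiv]
  simp [partialD]

/-- The x-derivatives of e^{2σ} add ¼ g^{ih}(2 σ_r y^r ∂̇_h F² − 2 σ_h F²) to the spray, and ½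
g^{ih} ∂̇_h F² = y^i. -/
theorem spray_localConformal (hF : IsFinslerOn F U) (hs : ContDiffOn ℝ ∞ s U) (hx : x ∈ U)
    (hy : y ≠ 0) (i : Fin n) :
    spray (localConformal s F) i x y = spray F i x y + (∑ r, partialD r s x * y r) * y i
      - (1 / 2) * ∑ r, partialD r s x * (sq F x y * gInv F i r x y) := by
  have hM := hF.minkowski x hx
  have h₁ : ∀ (f : LocalFn n) (r : Fin n),
      ContDiffOn ℝ ∞ (fun p : Coord n × Coord n => f p.1 p.2) (U ×ˢ {0}ᶜ) →
      baseD r (fun x y => Real.exp (2 * s x) * f x y) x y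
        = Real.exp (2 * s x) * (2 * partialD r s x * f x y + baseD r f x y) := fun f r hf =>
    ((hF.hasPartialD_exp hs hx r).mul (hF.hasPartialD_base hf hx hy r)).2.trans (by ring)
  -- Writing y^i as a sum over h makes the whole identity a termwise one.
  have h₂ : y i = ∑ h, gInv F i h x y * ((1 / 2) * dotD h (sq F) x y) := by
    rw [← hM.F_mul_ellU hy, ellU, Finset.mul_sum]
    exact Finset.sum_congr rfl fun h _ => by rw [hM.dotD_sq hy]; ring
  have he := Real.exp_ne_zero (2 * s x)
  rw [h₂]
  simp only [spray, hF.gInv_localConformal hx hy, dotD_sq_localConformal]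
  simp only [sq_localConformal,
    h₁ _ _ hF.contDiffOn_sq, h₁ _ _ (contDiffOn_dotD hF.isOpen_prod hF.contDiffOn_sq _)]
  obtain ⟨Y, hY⟩ : ∃ Y, ∑ r, partialD r s x * y r = Y := ⟨_, rfl⟩
  have h₃ : ∀ h, ∑ r, y r * (Real.exp (2 * s x) * (2 * partialD r s x * dotD h (sq F) x y
      + baseD r (dotD h (sq F)) x y)) = Real.exp (2 * s x) * (2 * Y * dotD h (sq F) x y
      + ∑ r, y r * baseD r (dotD h (sq F)) x y) := by
    intro h
    rw [← hY]
    simp only [mul_add, Finset.mul_sum, Finset.sum_mul, ← Finset.sum_add_distrib]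
    exact Finset.sum_congr rfl fun r _ => by ring
  simp only [h₃, hY]
  obtain ⟨Z, hZ⟩ : ∃ Z : Fin n → ℝ, ∀ h, ∑ r, y r * baseD r (dotD h (sq F)) x y = Z h :=
    ⟨_, fun _ => rfl⟩
  simp only [hZ, Finset.mul_sum, ← Finset.sum_add_distrib, ← Finset.sum_sub_distrib]
  refine Finset.sum_congr rfl fun h _ => ?_
  field_simp
  ring

theorem berwaldTensor_localConformal (hF : IsFinslerOn F U) (hs : ContDiffOn ℝ ∞ s U)
    (hx : x ∈ U) (hy : y ≠ 0) (i j k h : Fin n) :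
    berwaldTensor (localConformal s F) i j k h x y
      = berwaldTensor F i j k h x y + conformalB F s i j k h x y := by
  have hM := hF.minkowski x hx
  have hA₀ := hF.contDiffOn_spray hx i
  have hA₁ : ContDiffOn ℝ ∞ (nonlinearConn F i j x) {0}ᶜ :=
    hA₀.partialD isOpen_compl_singleton j
  have hA₂ : ContDiffOn ℝ ∞ (berwaldConn F i j k x) {0}ᶜ :=
    hA₁.partialD isOpen_compl_singleton k
  have hlin : ∀ (l : Fin n) (z : Coord n),
      HasPartialD l (fun z => ∑ r, partialD r s x * z r) (partialD l s x) z := fun l z =>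
    (HasPartialD.sum fun r _ => (HasPartialD.coord r).const_mul _).congr_deriv (by simp)
  set E : Fin n → LocalFn n := fun r x z => sq F x z * gInv F i r x z
  set δ : Fin n → ℝ := fun l => if i = l then 1 else 0
  have h₁ : ∀ z, z ≠ 0 → nonlinearConn (localConformal s F) i j x z = nonlinearConn F i j x z
      + (partialD j s x * z i + (∑ r, partialD r s x * z r) * δ j)
      - (1 / 2) * ∑ r, partialD r s x * dotD j (E r) x z := fun z hz =>
    (((((hasPartialD_of_contDiffOn hA₀ j hz).add ((hlin j z).mul (HasPartialD.coord i))).sub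
      ((HasPartialD.sum fun r _ => HasPartialD.const_mul (partialD r s x)
        ⟨(hM.hasPartialD_sq_mul_gInv hz i r j).1, rfl⟩).const_mul (1 / 2))).congr_of_ne_zero hz
      fun w hw => hF.spray_localConformal hs hx hw i)).2
  -- The quadratic term has become σ_j δ^i_k + σ_k δ^i_j, constant in y, so it disappears at the
  -- next derivative.
  have h₂ : ∀ z, z ≠ 0 → berwaldConn (localConformal s F) i j k x z = berwaldConn F i j k x z
      + (partialD j s x * δ k + partialD k s x * δ j)
      - (1 / 2) * ∑ r, partialD r s x * dotD k (dotD j (E r)) x z := fun z hz =>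
    ((((((hasPartialD_of_contDiffOn hA₁ k hz).add (((HasPartialD.coord i).const_mul _).add
      ((hlin k z).mul (HasPartialD.const (δ j))))).sub
      ((HasPartialD.sum fun r _ => HasPartialD.const_mul (partialD r s x)
        ⟨(hM.hasPartialD₂_sq_mul_gInv hz i r j k).1, rfl⟩).const_mul (1 / 2))).congr_of_ne_zero hz
      h₁)).congr_deriv (by simp only [mul_zero, add_zero]; rfl)).2
  have h₃ := ((((hasPartialD_of_contDiffOn hA₂ h hy).add (HasPartialD.const
      (partialD j s x * δ k + partialD k s x * δ j))).sub
      ((HasPartialD.sum fun r (_ : r ∈ Finset.univ) =>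
        (hM.hasPartialD₃_sq_mul_gInv hy i r j k h).const_mul (partialD r s x)).const_mul
          (1 / 2))).congr_of_ne_zero hy h₂).2
  refine Eq.trans h₃ ?_
  rw [add_zero, sub_eq_add_neg]
  refine congrArg₂ (· + ·) rfl ?_
  -- Only −½ · (−2) = 1 remains to be collected.
  rw [conformalB, Finset.mul_sum, ← Finset.sum_neg_distrib]
  exact Finset.sum_congr rfl fun r _ => by ring

end IsFinslerOn

/-! ### Coordinate expressions of Finsler structures on manifolds -/

section Manifold

variable {M : Type*} [TopologicalSpace M] [ChartedSpace (EuclideanSpace ℝ (Fin n)) M]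

/-- The derivative of φ is a left inverse, since φ ∘ φ⁻¹ is the identity near x. Hence nonzero
coordinates y give vectors of the slit bundle, where F is smooth and positive. -/
theorem mfderiv_symm_ne_zero {φ : OpenPartialHomeomorph M (Coord n)}
    (hφ : φ ∈ IsManifold.maximalAtlas (𝓡 n) ∞ M) {x y : Coord n} (hx : x ∈ φ.target)
    (hy : y ≠ 0) : mfderiv (𝓡 n) (𝓡 n) φ.symm x y ≠ 0 := by
  have hs : MDifferentiableAt (𝓡 n) (𝓡 n) φ.symm x :=
    ((contMDiffOn_symm_of_mem_maximalAtlas hφ).contMDiffAt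
      (φ.open_target.mem_nhds hx)).mdifferentiableAt (by simp)
  have hd : MDifferentiableAt (𝓡 n) (𝓡 n) φ (φ.symm x) :=
    (contMDiffAt_of_mem_maximalAtlas hφ (φ.map_target hx)).mdifferentiableAt (by simp)
  have hc := mfderiv_comp x hd hs
  have he : (φ ∘ φ.symm) =ᶠ[nhds x] id :=
    Filter.eventually_of_mem (φ.open_target.mem_nhds hx) fun z hz => φ.right_inv hz
  rw [he.mfderiv_eq, mfderiv_id] at hc
  intro h0
  apply hy
  have := congrArg (fun A => A y) hc
  erw [ContinuousLinearMap.comp_apply, h0, map_zero] at this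
  exact this

/-- The coordinate expression is F composed with the tangent map of φ⁻¹ and the identification of ℝⁿ
× ℝⁿ with the tangent bundle of the model space. -/
theorem contDiffOn_localExpr [IsManifold (𝓡 n) ∞ M] {F : TangentBundle (𝓡 n) M → ℝ}
    (hF : ContMDiffOn (𝓡 n).tangent 𝓘(ℝ, ℝ) ∞ F {v | v.2 ≠ 0})
    {φ : OpenPartialHomeomorph M (Coord n)} (hφ : φ ∈ IsManifold.maximalAtlas (𝓡 n) ∞ M) :
    ContDiffOn ℝ ∞ (fun p : Coord n × Coord n => localExpr φ F p.1 p.2)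
      (φ.target ×ˢ {0}ᶜ) := by
  have ht : ContMDiffOn (𝓡 n).tangent (𝓡 n).tangent ∞
      (tangentMapWithin (𝓡 n) (𝓡 n) φ.symm φ.target) (Bundle.TotalSpace.proj ⁻¹' φ.target) :=
    (contMDiffOn_symm_of_mem_maximalAtlas hφ).contMDiffOn_tangentMapWithin le_rfl
      φ.open_target.uniqueMDiffOn
  have hm : ContMDiff ((𝓡 n).prod 𝓘(ℝ, Coord n)) (𝓡 n).tangent ∞
      (tangentBundleModelSpaceHomeomorph (𝓡 n)).symm :=
    contMDiff_tangentBundleModelSpaceHomeomorph_symm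
  have hi : ContMDiff 𝓘(ℝ, Coord n × Coord n) (𝓡 n).tangent ∞
      ((tangentBundleModelSpaceHomeomorph (𝓡 n)).symm ∘
        fun p : Coord n × Coord n => ((p.1, p.2) : ModelProd (Coord n) (Coord n))) := by
    refine hm.comp ?_
    have := (contDiff_fst (𝕜 := ℝ) (E := Coord n) (F := Coord n) (n := ∞)).contMDiff.prodMk
      (contDiff_snd (𝕜 := ℝ) (E := Coord n) (F := Coord n) (n := ∞)).contMDiff
    convert! this
    rw [chartedSpaceSelf_prod]
    rfl
  rw [← contMDiffOn_iff_contDiffOn]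
  have hfun : ∀ p ∈ φ.target ×ˢ ({0}ᶜ : Set (Coord n)),
      (tangentMapWithin (𝓡 n) (𝓡 n) φ.symm φ.target ∘
        (tangentBundleModelSpaceHomeomorph (𝓡 n)).symm ∘
          fun p : Coord n × Coord n => ((p.1, p.2) : ModelProd (Coord n) (Coord n))) p =
        (⟨φ.symm p.1, mfderiv (𝓡 n) (𝓡 n) φ.symm p.1 p.2⟩ : TangentBundle (𝓡 n) M) := by
    intro p hp
    simp only [Function.comp_apply, tangentMapWithin]
    -- On the open target the derivative within the set is the full derivative used by `localExpr`.
    erw [mfderivWithin_of_isOpen φ.open_target hp.1]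
    rfl
  refine (hF.comp (ht.comp hi.contMDiffOn (s := φ.target ×ˢ {0}ᶜ) fun p hp => hp.1)
    fun p hp => ?_).congr fun p hp => ?_
  · rw [Set.mem_preimage, hfun p hp]
    exact mfderiv_symm_ne_zero hφ hp.1 hp.2
  · exact (congrArg F (hfun p hp)).symm

theorem localExpr_homogeneous [IsManifold (𝓡 n) ∞ M] {F : TangentBundle (𝓡 n) M → ℝ}
    (hF : IsFinslerStructure F) (φ : OpenPartialHomeomorph M (Coord n)) (x y : Coord n) (c : ℝ)
    (hc : 0 < c) : localExpr φ F x (c • y) = c * localExpr φ F x y := by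
  have h := hF.homogeneous (φ.symm x) (mfderiv (𝓡 n) (𝓡 n) φ.symm x y) c hc
  rw [localExpr, localExpr, ← h]
  congr 2
  exact map_smul _ c y

theorem IsFinslerStructure.isFinslerOn [IsManifold (𝓡 n) ∞ M] {F : TangentBundle (𝓡 n) M → ℝ}
    (hF : IsFinslerStructure F) {φ : OpenPartialHomeomorph M (Coord n)}
    (hφ : φ ∈ IsManifold.maximalAtlas (𝓡 n) ∞ M) : IsFinslerOn (localExpr φ F) φ.target where
  isOpen := φ.open_target
  smooth := contDiffOn_localExpr hF.smooth hφ
  minkowski x hx :=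
    { smooth := IsFinslerOn.contDiffOn_fiber (contDiffOn_localExpr hF.smooth hφ) hx
      pos := fun _ hy => (hF.nonneg _).lt_of_ne fun h0 =>
        mfderiv_symm_ne_zero hφ hx hy ((hF.eq_zero_iff _).1 h0.symm)
      homogeneous := fun _ _ hc => localExpr_homogeneous hF φ x _ _ hc
      posDef := hF.posDef φ hφ x hx }

end Manifold

end Finsler

end

theorem mainTheorem1 {n : ℕ} {M : Type*} [TopologicalSpace M]
    [ChartedSpace (EuclideanSpace ℝ (Fin n)) M] [IsManifold (𝓡 n) ∞ M]
    (F : TangentBundle (𝓡 n) M → ℝ) (hF : Finsler.IsFinslerStructure F)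
    (σ : M → ℝ) (hσ : ContMDiff (𝓡 n) 𝓘(ℝ, ℝ) ∞ σ)
    (φ : OpenPartialHomeomorph M (EuclideanSpace ℝ (Fin n)))
    (hφ : φ ∈ IsManifold.maximalAtlas (𝓡 n) ∞ M)
    (x : EuclideanSpace ℝ (Fin n)) (hx : x ∈ φ.target)
    (y : EuclideanSpace ℝ (Fin n)) (hy : y ≠ 0) (i j k h : Fin n) :
    Finsler.berwaldTensor (Finsler.localExpr φ (Finsler.conformal σ F)) i j k h x y =
        Finsler.berwaldTensor (Finsler.localExpr φ F) i j k h x y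
          + Finsler.conformalB (Finsler.localExpr φ F) (σ ∘ φ.symm) i j k h x y ∧
      Finsler.conformalB (Finsler.localExpr φ F) (σ ∘ φ.symm) i j k h x y =
        Finsler.conformalBT (Finsler.localExpr φ F) (σ ∘ φ.symm) i j k h x y := by
  have hF' := hF.isFinslerOn hφ
  have hs : ContDiffOn ℝ ∞ (σ ∘ φ.symm) φ.target := contMDiffOn_iff_contDiffOn.1
    (hσ.comp_contMDiffOn (contMDiffOn_symm_of_mem_maximalAtlas hφ))
  -- The coordinate expression of e^σ F unfolds definitionally to `localConformal (σ ∘ φ.symm)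
  -- (localExpr φ F)`.
  refine ⟨hF'.berwaldTensor_localConformal hs hx hy i j k h, ?_⟩
  exact Finset.sum_congr rfl fun r _ =>
    congrArg _ ((hF'.minkowski x hx).conformalB_coeff_eq hy i r j k h)
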